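/- Write $B_\delta$ for the $\delta$-neighborhood of the segment $\{(0,0,t): -1/2\le t\le 0\}$ and $|A_M|^2$ for the squared norm of the second fundamental form of a surface $M\subset\mathbf R^3$. A compact embedded disk is the image $M=F(D)$ of a closed topological disk $D\subset\mathbf R^2$ with piecewise smooth boundary under an injective immersion $F$ that is $C^\infty$ on a neighborhood of $D$; its boundary is $\partial M=F(\partial D)$, and $M$ is minimal if its mean curvature vanishes. A multi-valued graph over the punctured plane $\{x_3=0\}\setminus\{0\}$ is an embedded surface $\{(\rho\cos\theta,\rho\sin\theta,u(\rho,\theta)):(\rho,\theta)\in\Omega\}$, where $u$ is a smooth function on a connected subset $\Omega$ of the universal cover $\{(\rho,\theta):\rho>0,\ \theta\in\mathbf R\}$ of the punctured plane, and $\Omega$ contains two points $(\rho,\theta)$ and $(\rho,\theta+2\pi)$. Theorem. There exists a sequence of compact embedded minimal disks $0\in M_N\subset \mathbf R^2\times[-1/2,1/2]\subset\mathbf R^3$, each containing the vertical segment $\{(0,0,t): |t|\le 1/2\}$, with the following properties: (a) For every $p\in\{(0,0,t): -1/2\le t\le 0\}$, $\lim_{N\to\infty}|A_{M_N}|^2(p)=\infty$.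 (b) For every $N$, $M_N\setminus\{(0,0,t): |t|\le 1/2\}$ is the disjoint union $M_{1,N}\cup M_{2,N}$ of two multi-valued graphs over the punctured plane $\{x_3=0\}\setminus\{0\}$. (c) For every $\delta>0$, $\sup_N\sup_{M_N\setminus B_\delta}|A_{M_N}|^2=C_\delta<\infty$. (d) There is $r_0>0$, independent of $N$, such that for every $N$ the boundary $\partial M_N$ does not meet the cylinder $\{x_1^2+x_2^2\le r_0^2,\ -1/2<x_3<1/2\}$. Moreover, let $\Gamma_N$ be the lateral part of $\partial M_N$, that is, the closure of $\partial M_N\cap\{|x_3|<1/2\}$. Then for every $t\in[-1/2,0]$ the distance from the $x_3$-axis to $\Gamma_N\cap\{x_3=t\}$ tends to infinity as $N\to\infty$. (For $-1/2<t\le 0$, $\Gamma_N\cap\{x_3=t\}=\partial M_N\cap\{x_3=t\}$.) -/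

import Mathlib

open Set Filter Topology Metric
open scoped ContDiff

noncomputable section

/-- Euclidean three-space with its standard coordinates `p 0, p 1, p 2`. -/
abbrev R3 : Type := EuclideanSpace ℝ (Fin 3)

/-- The coordinate directions of the parameter plane, which is `ℂ` regarded as `ℝ²`. -/
def paramDir : Fin 2 → ℂ := ![1, Complex.I]

/-- Coefficients `g_ij` of the first fundamental form (induced metric) of the map `F` at `z`. -/
def firstFundamentalForm (F : ℂ → R3) (z : ℂ) : Matrix (Fin 2) (Fin 2) ℝ :=
  Matrix.of fun i j => inner ℝ (fderiv ℝ F z (paramDir i)) (fderiv ℝ F z (paramDir j))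

/-- The tangent plane of the map `F` at `z`, as a linear subspace of `ℝ³`. -/
def tangentPlane (F : ℂ → R3) (z : ℂ) : Submodule ℝ R3 :=
  LinearMap.range (fderiv ℝ F z).toLinearMap

/-- The (normal-vector valued) second fundamental form `A_ij` of the map `F` at `z`:
the normal component of the second derivative `∂_i ∂_j F`. -/
def secondFundamentalForm (F : ℂ → R3) (z : ℂ) (i j : Fin 2) : R3 :=
  (tangentPlane F z)ᗮ.starProjection
    (fderiv ℝ (fderiv ℝ F) z (paramDir i) (paramDir j))

/-- The mean curvature vector `g^{ij} A_ij`. -/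
def meanCurvatureVector (F : ℂ → R3) (z : ℂ) : R3 :=
  ∑ i, ∑ j, ((firstFundamentalForm F z)⁻¹ i j) • secondFundamentalForm F z i j

/-- The squared norm `|A|² = g^{ik} g^{jl} ⟨A_ij, A_kl⟩` of the second fundamental form. -/
def sffNormSq (F : ℂ → R3) (z : ℂ) : ℝ :=
  ∑ i, ∑ j, ∑ k, ∑ l,
    (firstFundamentalForm F z)⁻¹ i k * (firstFundamentalForm F z)⁻¹ j l *
      inner ℝ (secondFundamentalForm F z i j) (secondFundamentalForm F z k l)

/-- A set in the plane has piecewise smooth boundary: its frontier is a finite union of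
regular smooth embedded arcs. -/
def HasPiecewiseSmoothBoundary (D : Set ℂ) : Prop :=
  ∃ (n : ℕ) (γ : Fin n → ℝ → ℂ),
    (∀ i, ContDiffOn ℝ ∞ (γ i) (Icc 0 1) ∧ InjOn (γ i) (Icc 0 1) ∧
      ∀ s ∈ Icc (0 : ℝ) 1, derivWithin (γ i) (Icc 0 1) s ≠ 0) ∧
    frontier D = ⋃ i, γ i '' Icc 0 1

/-- A compact embedded disk in `ℝ³`, smooth up to its piecewise smooth boundary: the image of
a closed topological disk `domain` in the plane, with piecewise smooth boundary, under an
injective immersion which is smooth on a neighbourhood of `domain`. -/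
structure CompactEmbeddedDisk where
  domain : Set ℂ
  param : ℂ → R3
  isDisk : Nonempty (domain ≃ₜ closedBall (0 : ℂ) 1)
  piecewiseSmooth : HasPiecewiseSmoothBoundary domain
  smooth : ∃ U : Set ℂ, IsOpen U ∧ domain ⊆ U ∧ ContDiffOn ℝ ∞ param U
  immersion : ∀ z ∈ domain, Function.Injective (fderiv ℝ param z)
  injOn : InjOn param domain

namespace CompactEmbeddedDisk

/-- The surface itself, as a subset of `ℝ³`. -/
def carrier (M : CompactEmbeddedDisk) : Set R3 := M.param '' M.domain

/-- The boundary curve `∂M`. -/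
def boundary (M : CompactEmbeddedDisk) : Set R3 := M.param '' frontier M.domain

/-- The disk is minimal: its mean curvature vanishes identically. -/
def IsMinimal (M : CompactEmbeddedDisk) : Prop :=
  ∀ z ∈ M.domain, meanCurvatureVector M.param z = 0

/-- `|A_M|²(p)` at a point `p` of the surface `M`. -/
def normSqA (M : CompactEmbeddedDisk) (p : R3) : ℝ :=
  sffNormSq M.param (Function.invFunOn M.param M.domain p)

/-- The lateral part of the boundary of a disk in the slab `|x₃| ≤ 1/2`: the closure of the
part of `∂M` in the open slab. Over `|x₃| < 1/2` it coincides with `∂M`; what is left out of `∂M`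
is in the planes `x₃ = ±1/2`. -/
def lateralBoundary (M : CompactEmbeddedDisk) : Set R3 :=
  closure (M.boundary ∩ {p | |p 2| < 1 / 2})

end CompactEmbeddedDisk

/-- The segment `{(0,0,t) : a ≤ t ≤ b}` of the `x₃`-axis. -/
def axisSegment (a b : ℝ) : Set R3 := {p | p 0 = 0 ∧ p 1 = 0 ∧ p 2 ∈ Icc a b}

/-- Distance of a point to the `x₃`-axis. -/
def axisDist (p : R3) : ℝ := Real.sqrt (p 0 ^ 2 + p 1 ^ 2)

/-- The point of `ℝ³` at height `u (ρ, θ)` over the point with polar coordinates `(ρ, θ)`. -/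
def polarGraphMap (u : ℝ × ℝ → ℝ) (q : ℝ × ℝ) : R3 :=
  !₂[q.1 * Real.cos q.2, q.1 * Real.sin q.2, u q]

/-- `S` is an embedded multi-valued graph over the punctured plane: the graph of a smooth function
`u` over a connected set `Ω` in the universal cover `{(ρ, θ) : ρ > 0, θ ∈ ℝ}` of the punctured
plane, with at least two sheets somewhere, and embedded in `ℝ³`. -/
def IsMultivaluedGraph (S : Set R3) : Prop :=
  ∃ (Ω : Set (ℝ × ℝ)) (u : ℝ × ℝ → ℝ),
    (∀ q ∈ Ω, 0 < q.1) ∧ IsConnected Ω ∧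
    (∃ ρ θ : ℝ, (ρ, θ) ∈ Ω ∧ (ρ, θ + 2 * Real.pi) ∈ Ω) ∧
    ContDiffOn ℝ ∞ u Ω ∧
    IsEmbedding (Ω.domRestrict (polarGraphMap u)) ∧
    S = polarGraphMap u '' Ω

end

/-!
The disks are given by the Weierstrass representation with height differential `dz` and Gauss map
`e^{ih}`, where `h(z) = -∑_{n=1}^N e^{-nz}` is entire and real on the real axis. With `h = u + iv`
and `z = x + iy`, the height is `x` and the horizontal part `P : ℂ → ℂ` satisfies
`P_x = e^{iu} sinh v` and `P_y = -i e^{iu} cosh v`, so the real axis is mapped to the `x₃`-axis and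
`|A|² = 2 |h'|² / cosh⁴ v`.

On the real axis `h'(x) = ∑ n e^{-nx}`. This is at least `N` for `x ≤ 0` and bounded uniformly in
`N` for `x ≥ δ > 0`, which is where the curvature blows up, respectively stays bounded. The
parameter domain is `|x| ≤ 1/2`, `|y| ≤ Y(x)`, with `Y` a small multiple of `h'(x)^{-3/4}`. The
convolution inequality `∑ n³ e^{-nx} ≤ 6 (∑ n e^{-nx})² + ∑ n e^{-nx}` (`expMoment_three_le`) shows that this
width is small enough for `u` to be almost constant on vertical segments and for `v` to be at least
`h'(x) y / 2` there. It is also large enough: the slice at height `x` leaves every cylinder of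
radius a small multiple of `h'(x)^{1/4}` (`le_norm_horizPart_halfWidth`), because its speed is
`cosh v`. Conversely its length is at most `Y cosh v`, so away from the axis `cosh v` is bounded
below by a multiple of `h'(x)^{3/4}`, which bounds `|A|²` (`sffNormSq_le_of_le_norm`).

Since `u` is almost constant on vertical segments, every slice is a graph over a line, hence the
disk is embedded. For `y > 0` the polar coordinates `(ρ, θ)` of `P`, with `θ` the branch close to
`u(x) - π / 2`, are an injective immersion (`injOn_logPart`): two points with equal `θ` have nearly
equal values of `u` on the axis, and are joined by a horizontal and a vertical segment of the domain
(`Y` is increasing) along which `P` moves in nearly orthogonal directions. This makes the half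
`y > 0` a multi-valued graph; the other half is its image under the half turn about the axis,
because `P` changes sign under conjugation. Following the surface on a small cylinder from height
`-1/2` to `1/2`, the angle grows by about `∑ (e^{n/2} - e^{-n/2}) ≥ N`, whence there are two sheets.
-/

noncomputable section

/-! ### Exponential moments and the phase -/

/-- The exponential moment `∑_{n=1}^N n^k e^{-nx}`. -/
def expMoment (N k : ℕ) (x : ℝ) : ℝ :=
  ∑ n ∈ Finset.range N, ((n : ℝ) + 1) ^ k * Real.exp (-(((n : ℝ) + 1) * x))

theorem expMoment_nonneg (N k : ℕ) (x : ℝ) : 0 ≤ expMoment N k x :=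
  Finset.sum_nonneg fun n _ => by positivity

theorem expMoment_pos {N : ℕ} (hN : 0 < N) (k : ℕ) (x : ℝ) : 0 < expMoment N k x :=
  Finset.sum_pos (fun n _ => by positivity) ⟨0, by simpa using hN⟩

theorem contDiff_expMoment (N k : ℕ) : ContDiff ℝ ∞ (expMoment N k) := by
  unfold expMoment
  fun_prop

theorem antitone_expMoment (N k : ℕ) : Antitone (expMoment N k) := by
  intro x y hxy
  unfold expMoment
  gcongr

theorem exp_neg_one_le_expMoment {N : ℕ} (hN : 0 < N) (k : ℕ) {x : ℝ} (hx : x ≤ 1) :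
    Real.exp (-1) ≤ expMoment N k x := by
  have h : ((0 : ℕ) + 1 : ℝ) ^ k * Real.exp (-(((0 : ℕ) + 1 : ℝ) * x)) ≤ expMoment N k x :=
    Finset.single_le_sum (f := fun n : ℕ => ((n : ℝ) + 1) ^ k * Real.exp (-(((n : ℝ) + 1) * x)))
      (fun n _ => by positivity) (by simpa using hN)
  refine le_trans ?_ h
  simp only [Nat.cast_zero, zero_add, one_pow, one_mul]
  gcongr

theorem sum_antidiagonal_mul (m : ℕ) :
    ∑ p ∈ Finset.HasAntidiagonal.antidiagonal m, (p.1 : ℝ) * p.2 = ((m : ℝ) ^ 3 - m) / 6 := by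
  have key : ∀ (c : ℝ) (M : ℕ), ∑ j ∈ Finset.range M, (j : ℝ) * (c - j) =
      c * (M * (M - 1)) / 2 - M * (M - 1) * (2 * M - 1) / 6 := by
    intro c M
    induction M with
    | zero => simp
    | succ M ih => rw [Finset.sum_range_succ, ih]; push_cast; ring
  rw [Finset.Nat.sum_antidiagonal_eq_sum_range_succ (fun i j : ℕ => (i : ℝ) * j)]
  have : ∀ j ∈ Finset.range m.succ, (j : ℝ) * ((m - j : ℕ) : ℝ) = (j : ℝ) * ((m : ℝ) - j) := by
    intro j hj
    rw [Nat.cast_sub (by simpa [Nat.lt_succ_iff] using hj)]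
  rw [Finset.sum_congr rfl this, key]
  push_cast
  ring

theorem expMoment_eq_sum_range_succ (N k : ℕ) (hk : k ≠ 0) (x : ℝ) :
    expMoment N k x = ∑ m ∈ Finset.range (N + 1), (m : ℝ) ^ k * Real.exp (-x) ^ m := by
  rw [Finset.sum_range_succ', expMoment]
  simp only [Nat.cast_zero, ne_eq, hk, not_false_eq_true, zero_pow, zero_mul, add_zero]
  refine Finset.sum_congr rfl fun n _ => ?_
  rw [← Real.exp_nat_mul]
  push_cast
  ring_nf

/-- The square of the first moment contains all products `jk e^{-(j+k)x}` with `j + k ≤ N`, and the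
coefficient of `e^{-mx}` in the sum of these is `(m³ - m) / 6`. -/
theorem expMoment_three_le (N : ℕ) (x : ℝ) :
    expMoment N 3 x ≤ 6 * expMoment N 1 x ^ 2 + expMoment N 1 x := by
  rw [expMoment_eq_sum_range_succ N 3 (by simp), expMoment_eq_sum_range_succ N 1 (by simp)]
  set w := Real.exp (-x)
  have hw : 0 < w := Real.exp_pos _
  set a : ℕ → ℝ := fun j => (j : ℝ) ^ 1 * w ^ j
  have h1 : ∀ m ∈ Finset.range (N + 1),
      ((m : ℝ) ^ 3 - m) / 6 * w ^ m =
        ∑ p ∈ Finset.range (N + 1) ×ˢ Finset.range (N + 1) with p.1 + p.2 = m, a p.1 * a p.2 := by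
    intro m hm
    have : {p ∈ Finset.range (N + 1) ×ˢ Finset.range (N + 1) | p.1 + p.2 = m} =
        Finset.HasAntidiagonal.antidiagonal m := by
      ext p
      simp only [Finset.mem_filter, Finset.mem_product, Finset.mem_range,
        Finset.HasAntidiagonal.mem_antidiagonal] at hm ⊢
      omega
    rw [this, ← sum_antidiagonal_mul, Finset.sum_mul]
    refine Finset.sum_congr rfl fun p hp => ?_
    rw [← Finset.HasAntidiagonal.mem_antidiagonal.1 hp, pow_add]
    simp only [a]
    ring
  have h2 : ∑ m ∈ Finset.range (N + 1), ((m : ℝ) ^ 3 - m) / 6 * w ^ m ≤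
      (∑ j ∈ Finset.range (N + 1), a j) ^ 2 := by
    rw [Finset.sum_congr rfl h1, sq, Finset.sum_mul_sum, ← Finset.sum_product']
    exact Finset.sum_fiberwise_le_sum_of_sum_fiber_nonneg fun m _ =>
      Finset.sum_nonneg fun p _ => by simp only [a]; positivity
  have h3 : ∑ m ∈ Finset.range (N + 1), (m : ℝ) ^ 3 * w ^ m =
      6 * (∑ m ∈ Finset.range (N + 1), ((m : ℝ) ^ 3 - m) / 6 * w ^ m) +
        ∑ m ∈ Finset.range (N + 1), a m := by
    rw [Finset.mul_sum, ← Finset.sum_add_distrib]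
    refine Finset.sum_congr rfl fun m _ => ?_
    simp only [a]
    ring
  rw [h3]
  linarith

theorem expMoment_two_sq_le (N : ℕ) (x : ℝ) :
    expMoment N 2 x ^ 2 ≤ expMoment N 1 x * expMoment N 3 x := by
  unfold expMoment
  refine Finset.sum_sq_le_sum_mul_sum_of_sq_le_mul _ (fun n _ => by positivity)
    (fun n _ => by positivity) fun n _ => le_of_eq (by ring)

/-- The fourth root of the first moment `∑ n e^{-nx}`. -/
def momentRoot (N : ℕ) (x : ℝ) : ℝ := √√(expMoment N 1 x)

theorem momentRoot_pos {N : ℕ} (hN : 0 < N) (x : ℝ) : 0 < momentRoot N x :=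
  Real.sqrt_pos.2 (Real.sqrt_pos.2 (expMoment_pos hN 1 x))

theorem momentRoot_pow_four (N : ℕ) (x : ℝ) : momentRoot N x ^ 4 = expMoment N 1 x := by
  rw [show 4 = 2 * 2 from rfl, pow_mul, momentRoot, Real.sq_sqrt (Real.sqrt_nonneg _),
    Real.sq_sqrt (expMoment_nonneg _ _ _)]

theorem contDiff_momentRoot {N : ℕ} (hN : 0 < N) : ContDiff ℝ ∞ (momentRoot N) :=
  ((contDiff_expMoment N 1).sqrt fun x => (expMoment_pos hN 1 x).ne').sqrt
    fun x => (Real.sqrt_pos.2 (expMoment_pos hN 1 x)).ne'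

theorem antitone_momentRoot (N : ℕ) : Antitone (momentRoot N) := fun _ _ h =>
  Real.sqrt_le_sqrt (Real.sqrt_le_sqrt (antitone_expMoment N 1 h))

theorem three_fifths_le_momentRoot_sq {N : ℕ} (hN : 0 < N) {x : ℝ} (hx : x ≤ 1) :
    3 / 5 ≤ momentRoot N x ^ 2 := by
  have h := exp_neg_one_le_expMoment hN 1 hx
  have he := Real.exp_neg_one_gt_d9
  rw [← momentRoot_pow_four] at h
  nlinarith [sq_nonneg (momentRoot N x)]

theorem expMoment_three_le_pow {N : ℕ} (hN : 0 < N) {x : ℝ} (hx : x ≤ 1) :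
    expMoment N 3 x ≤ 9 * momentRoot N x ^ 8 := by
  have h := exp_neg_one_le_expMoment hN 1 hx
  have he := Real.exp_neg_one_gt_d9
  have h3 := expMoment_three_le N x
  have : momentRoot N x ^ 8 = expMoment N 1 x ^ 2 := by rw [← momentRoot_pow_four]; ring
  rw [this]
  nlinarith

theorem expMoment_two_le_pow {N : ℕ} (hN : 0 < N) {x : ℝ} (hx : x ≤ 1) :
    expMoment N 2 x ≤ 3 * momentRoot N x ^ 6 := by
  have hq := momentRoot_pos hN x
  refine (sq_le_sq₀ (expMoment_nonneg _ _ _) (by positivity)).1 ?_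
  calc expMoment N 2 x ^ 2 ≤ expMoment N 1 x * expMoment N 3 x := expMoment_two_sq_le N x
    _ ≤ momentRoot N x ^ 4 * (9 * momentRoot N x ^ 8) := by
        rw [momentRoot_pow_four]
        exact mul_le_mul_of_nonneg_left (expMoment_three_le_pow hN hx) (expMoment_nonneg _ _ _)
    _ = (3 * momentRoot N x ^ 6) ^ 2 := by ring

/-- The half-width of the parameter domain over the point `x` of the real axis. It is proportional
to `(∑ n e^{-nx})^{-3/4}`. -/
def halfWidth (N : ℕ) (x : ℝ) : ℝ := 1 / (10 * momentRoot N x ^ 3)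

theorem halfWidth_pos {N : ℕ} (hN : 0 < N) (x : ℝ) : 0 < halfWidth N x := by
  have := momentRoot_pos hN x
  unfold halfWidth
  positivity

theorem contDiff_halfWidth {N : ℕ} (hN : 0 < N) : ContDiff ℝ ∞ (halfWidth N) := by
  refine contDiff_const.div (contDiff_const.mul ((contDiff_momentRoot hN).pow 3)) fun x => ?_
  have := momentRoot_pos hN x
  positivity

theorem monotone_halfWidth {N : ℕ} (hN : 0 < N) : Monotone (halfWidth N) := by
  intro x y hxy
  have := momentRoot_pos hN y
  have := antitone_momentRoot N hxy
  unfold halfWidth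
  gcongr

theorem halfWidth_mul_momentRoot {N : ℕ} (hN : 0 < N) (x : ℝ) :
    halfWidth N x * momentRoot N x ^ 3 = 1 / 10 := by
  have := momentRoot_pos hN x
  unfold halfWidth
  field_simp

theorem sq_mul_expMoment_two_le {N : ℕ} (hN : 0 < N) {x y : ℝ} (hx : x ≤ 1)
    (hy : |y| ≤ 2 * halfWidth N x) : y ^ 2 * expMoment N 2 x ≤ 3 / 25 := by
  have hq := momentRoot_pos hN x
  have h1 : y ^ 2 ≤ (2 * halfWidth N x) ^ 2 := sq_le_sq' (by linarith [(abs_le.1 hy).1])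
    (abs_le.1 hy).2
  calc y ^ 2 * expMoment N 2 x ≤ (2 * halfWidth N x) ^ 2 * (3 * momentRoot N x ^ 6) :=
        mul_le_mul h1 (expMoment_two_le_pow hN hx) (expMoment_nonneg _ _ _) (by positivity)
    _ = 12 * (halfWidth N x * momentRoot N x ^ 3) ^ 2 := by ring
    _ = 3 / 25 := by rw [halfWidth_mul_momentRoot hN]; norm_num

theorem sq_mul_expMoment_three_le {N : ℕ} (hN : 0 < N) {x y : ℝ} (hx : x ≤ 1)
    (hy : |y| ≤ 2 * halfWidth N x) : y ^ 2 * expMoment N 3 x ≤ expMoment N 1 x := by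
  have hq := momentRoot_pos hN x
  have h1 : y ^ 2 ≤ (2 * halfWidth N x) ^ 2 := sq_le_sq' (by linarith [(abs_le.1 hy).1])
    (abs_le.1 hy).2
  have h2 := three_fifths_le_momentRoot_sq hN hx
  calc y ^ 2 * expMoment N 3 x ≤ (2 * halfWidth N x) ^ 2 * (9 * momentRoot N x ^ 8) :=
        mul_le_mul h1 (expMoment_three_le_pow hN hx) (expMoment_nonneg _ _ _) (by positivity)
    _ = 36 * (halfWidth N x * momentRoot N x ^ 3) ^ 2 * momentRoot N x ^ 2 := by ring
    _ = 9 / 25 * momentRoot N x ^ 2 := by rw [halfWidth_mul_momentRoot hN]; norm_num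
    _ ≤ momentRoot N x ^ 2 * momentRoot N x ^ 2 := by gcongr; linarith
    _ = expMoment N 1 x := by rw [← momentRoot_pow_four]; ring

/-- The exponent `h(z) = -∑_{n=1}^N e^{-nz}` of the Gauss map `e^{ih}`. Its derivative on the real
axis is the first moment `∑ n e^{-nx}`. -/
def phase (N : ℕ) (z : ℂ) : ℂ := -∑ n ∈ Finset.range N, Complex.exp (-(((n : ℂ) + 1) * z))

/-- The derivative `∑_{n=1}^N n e^{-nz}` of `phase`. -/
def phaseDeriv (N : ℕ) (z : ℂ) : ℂ :=
  ∑ n ∈ Finset.range N, ((n : ℂ) + 1) * Complex.exp (-(((n : ℂ) + 1) * z))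

theorem hasDerivAt_phase (N : ℕ) (z : ℂ) : HasDerivAt (phase N) (phaseDeriv N z) z := by
  unfold phase phaseDeriv
  rw [← neg_neg (∑ n ∈ Finset.range N, _), ← Finset.sum_neg_distrib]
  refine (HasDerivAt.fun_sum fun n _ => ?_).neg
  have h : HasDerivAt (fun z : ℂ => -(((n : ℂ) + 1) * z)) (-((n : ℂ) + 1)) z := by
    simpa only [id, mul_one] using! ((hasDerivAt_id z).const_mul ((n : ℂ) + 1)).neg
  simpa only [mul_neg, neg_neg, neg_mul, mul_comm] using! h.cexp

theorem exp_neg_mul_re (n : ℕ) (z : ℂ) : (Complex.exp (-(((n : ℂ) + 1) * z))).re =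
    Real.exp (-(((n : ℝ) + 1) * z.re)) * Real.cos (((n : ℝ) + 1) * z.im) := by
  rw [Complex.exp_re]
  simp

theorem phase_re (N : ℕ) (z : ℂ) : (phase N z).re = -∑ n ∈ Finset.range N,
    Real.exp (-(((n : ℝ) + 1) * z.re)) * Real.cos (((n : ℝ) + 1) * z.im) := by
  simp [phase, -neg_add_rev, exp_neg_mul_re]

theorem phaseDeriv_re (N : ℕ) (z : ℂ) : (phaseDeriv N z).re = ∑ n ∈ Finset.range N,
    ((n : ℝ) + 1) * (Real.exp (-(((n : ℝ) + 1) * z.re)) * Real.cos (((n : ℝ) + 1) * z.im)) := by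
  simp [phaseDeriv, -neg_add_rev, exp_neg_mul_re]

theorem phase_conj (N : ℕ) (z : ℂ) :
    phase N ((starRingEnd ℂ) z) = (starRingEnd ℂ) (phase N z) := by
  simp [phase, ← Complex.exp_conj]

theorem phaseDeriv_conj (N : ℕ) (z : ℂ) :
    phaseDeriv N ((starRingEnd ℂ) z) = (starRingEnd ℂ) (phaseDeriv N z) := by
  simp [phaseDeriv, ← Complex.exp_conj]

theorem phase_ofReal (N : ℕ) (x : ℝ) : phase N x = ((-expMoment N 0 x : ℝ) : ℂ) := by
  simp [phase, expMoment]

theorem phaseDeriv_ofReal (N : ℕ) (x : ℝ) : phaseDeriv N x = (expMoment N 1 x : ℂ) := by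
  simp [phaseDeriv, expMoment]

theorem norm_phaseDeriv_le (N : ℕ) (z : ℂ) : ‖phaseDeriv N z‖ ≤ expMoment N 1 z.re := by
  refine (norm_sum_le _ _).trans (le_of_eq ?_)
  refine Finset.sum_congr rfl fun n _ => ?_
  rw [norm_mul, Complex.norm_exp, pow_one]
  congr 1
  · exact_mod_cast Complex.norm_natCast (n + 1)
  · simp

/-- On vertical lines the argument of the Gauss map varies little. -/
theorem phase_re_sub_mem (N : ℕ) (z : ℂ) : (phase N z).re + expMoment N 0 z.re ∈
    Icc 0 (z.im ^ 2 * expMoment N 2 z.re / 2) := by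
  have h : (phase N z).re + expMoment N 0 z.re = ∑ n ∈ Finset.range N,
      Real.exp (-(((n : ℝ) + 1) * z.re)) * (1 - Real.cos (((n : ℝ) + 1) * z.im)) := by
    rw [phase_re, expMoment, ← Finset.sum_neg_distrib, ← Finset.sum_add_distrib]
    exact Finset.sum_congr rfl fun n _ => by ring
  rw [h]
  refine ⟨Finset.sum_nonneg fun n _ => mul_nonneg (Real.exp_pos _).le
    (by linarith [Real.cos_le_one (((n : ℝ) + 1) * z.im)]), ?_⟩
  rw [expMoment, Finset.mul_sum, Finset.sum_div]
  refine Finset.sum_le_sum fun n _ => ?_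
  have := Real.one_sub_sq_div_two_le_cos (x := ((n : ℝ) + 1) * z.im)
  calc _ ≤ Real.exp (-(((n : ℝ) + 1) * z.re)) * ((((n : ℝ) + 1) * z.im) ^ 2 / 2) := by
        gcongr; linarith
    _ = _ := by ring

theorem expMoment_sub_le_phaseDeriv_re (N : ℕ) (z : ℂ) :
    expMoment N 1 z.re - z.im ^ 2 * expMoment N 3 z.re / 2 ≤ (phaseDeriv N z).re := by
  rw [phaseDeriv_re, expMoment, expMoment, Finset.mul_sum, Finset.sum_div,
    ← Finset.sum_sub_distrib]
  refine Finset.sum_le_sum fun n _ => ?_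
  have := Real.one_sub_sq_div_two_le_cos (x := ((n : ℝ) + 1) * z.im)
  calc _ = ((n : ℝ) + 1) * (Real.exp (-(((n : ℝ) + 1) * z.re)) *
          (1 - (((n : ℝ) + 1) * z.im) ^ 2 / 2)) := by ring
    _ ≤ _ := by gcongr

theorem hasDerivAt_vertical {f : ℂ → ℂ} {f' : ℂ} {x s : ℝ}
    (h : HasDerivAt f f' (x + s * Complex.I)) :
    HasDerivAt (fun s : ℝ => f (x + s * Complex.I)) (f' * Complex.I) s := by
  have h2 : HasDerivAt (fun s : ℝ => (x : ℂ) + s * Complex.I) Complex.I s := by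
    simpa using ((hasDerivAt_id s).ofReal_comp.mul_const Complex.I).const_add (x : ℂ)
  exact HasDerivAt.comp s h h2

theorem HasDerivAt.re_comp {f : ℝ → ℂ} {f' : ℂ} {s : ℝ} (h : HasDerivAt f f' s) :
    HasDerivAt (fun s => (f s).re) f'.re s :=
  Complex.reCLM.hasFDerivAt.comp_hasDerivAt s h

theorem HasDerivAt.im_comp {f : ℝ → ℂ} {f' : ℂ} {s : ℝ} (h : HasDerivAt f f' s) :
    HasDerivAt (fun s => (f s).im) f'.im s :=
  Complex.imCLM.hasFDerivAt.comp_hasDerivAt s h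

theorem half_expMoment_le_phaseDeriv_re {N : ℕ} (hN : 0 < N) {z : ℂ} (hx : z.re ≤ 1)
    (hy : |z.im| ≤ 2 * halfWidth N z.re) : expMoment N 1 z.re / 2 ≤ (phaseDeriv N z).re := by
  have h1 := expMoment_sub_le_phaseDeriv_re N z
  have h2 := sq_mul_expMoment_three_le hN hx hy
  linarith

theorem hasDerivAt_phase_im_vertical (N : ℕ) (x s : ℝ) :
    HasDerivAt (fun s : ℝ => (phase N (x + s * Complex.I)).im)
      (phaseDeriv N (x + s * Complex.I)).re s := by
  have h := (hasDerivAt_vertical (hasDerivAt_phase N (x + s * Complex.I))).im_comp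
  simpa using h

theorem phase_im_sub_ge {N : ℕ} (hN : 0 < N) {x s t : ℝ} (hx : x ≤ 1) (hs : 0 ≤ s) (hst : s ≤ t)
    (ht : t ≤ 2 * halfWidth N x) : expMoment N 1 x / 2 * (t - s) ≤
      (phase N (x + t * Complex.I)).im - (phase N (x + s * Complex.I)).im := by
  have hd := fun r => hasDerivAt_phase_im_vertical N x r
  have := (convex_Icc s t).mul_sub_le_image_sub_of_le_deriv
    (f := fun s : ℝ => (phase N (x + s * Complex.I)).im)
    (fun r _ => (hd r).continuousAt.continuousWithinAt)
    (fun r _ => (hd r).differentiableAt.differentiableWithinAt)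
    (C := expMoment N 1 x / 2) (fun r hr => by
      rw [interior_Icc] at hr
      rw [(hd r).deriv]
      have := half_expMoment_le_phaseDeriv_re hN (z := x + r * Complex.I) (by simpa using hx)
        (by simpa [abs_of_nonneg (hs.trans hr.1.le)] using hr.2.le.trans ht)
      simpa using this)
    s ⟨le_rfl, hst⟩ t ⟨hst, le_rfl⟩ hst
  exact this

theorem phase_im_ge {N : ℕ} (hN : 0 < N) {x t : ℝ} (hx : x ≤ 1) (h0 : 0 ≤ t)
    (ht : t ≤ 2 * halfWidth N x) :
    expMoment N 1 x / 2 * t ≤ (phase N (x + t * Complex.I)).im := by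
  have := phase_im_sub_ge hN hx le_rfl h0 ht
  have h0 : (phase N x).im = 0 := by rw [phase_ofReal]; simp
  simpa [h0] using this

/-! ### The minimal immersion and its second fundamental form -/

/-- The meromorphic Gauss map `e^{ih}` of the surface. -/
def gaussMap (N : ℕ) (z : ℂ) : ℂ := Complex.exp (Complex.I * phase N z)

theorem hasDerivAt_gaussMap (N : ℕ) (z : ℂ) :
    HasDerivAt (gaussMap N) (Complex.I * phaseDeriv N z * gaussMap N z) z := by
  have h := ((hasDerivAt_phase N z).const_mul Complex.I).cexp
  rwa [mul_comm] at h

theorem exists_gaussPrimitive (N : ℕ) : ∃ g : ℂ → ℂ, ∀ z, HasDerivAt g (gaussMap N z) z := by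
  have hd : Differentiable ℂ (gaussMap N) := fun z => (hasDerivAt_gaussMap N z).differentiableAt
  obtain ⟨g, hg⟩ := hd.isExactOn_univ
  exact ⟨g, fun z => hg z (mem_univ z)⟩

/-- An entire primitive of the Gauss map. -/
def gaussPrimitive (N : ℕ) : ℂ → ℂ := (exists_gaussPrimitive N).choose

theorem hasDerivAt_gaussPrimitive (N : ℕ) (z : ℂ) :
    HasDerivAt (gaussPrimitive N) (gaussMap N z) z :=
  (exists_gaussPrimitive N).choose_spec z

/-- The horizontal part `x₁ + i x₂` of the Weierstrass representation with Gauss map `e^{ih}` and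
height differential `dz`. Since `h` is real on the real axis, it is the integral of
`-e^{ih} / 2` from `conj z` to `z`. -/
def horizPart (N : ℕ) (z : ℂ) : ℂ :=
  -(gaussPrimitive N z - gaussPrimitive N ((starRingEnd ℂ) z)) / 2

theorem horizPart_conj (N : ℕ) (z : ℂ) :
    horizPart N ((starRingEnd ℂ) z) = -horizPart N z := by
  simp only [horizPart, Complex.conj_conj]
  ring

theorem horizPart_ofReal (N : ℕ) (x : ℝ) : horizPart N x = 0 := by
  simp [horizPart]

theorem contDiff_horizPart (N : ℕ) : ContDiff ℝ ∞ (horizPart N) := by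
  have hd : Differentiable ℂ (gaussPrimitive N) :=
    fun z => (hasDerivAt_gaussPrimitive N z).differentiableAt
  have h : ContDiff ℝ ∞ (gaussPrimitive N) := hd.contDiff.restrict_scalars ℝ
  have h2 : ContDiff ℝ ∞ (fun z : ℂ => gaussPrimitive N ((starRingEnd ℂ) z)) :=
    h.comp Complex.conjCLE.contDiff
  exact (h.sub h2).neg.div_const 2

/-- The real derivative of `horizPart`. -/
def horizPartDeriv (N : ℕ) (z : ℂ) : ℂ →L[ℝ] ℂ :=
  (-(1 / 2) : ℂ) • (gaussMap N z • ContinuousLinearMap.id ℝ ℂ -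
    gaussMap N ((starRingEnd ℂ) z) • (Complex.conjCLE : ℂ →L[ℝ] ℂ))

theorem horizPartDeriv_apply (N : ℕ) (z w : ℂ) : horizPartDeriv N z w =
    -(gaussMap N z * w - gaussMap N ((starRingEnd ℂ) z) * (starRingEnd ℂ) w) / 2 := by
  simp [horizPartDeriv]
  ring

theorem hasFDerivAt_comp_conj {f : ℂ → ℂ} {f' z : ℂ}
    (h : HasDerivAt f f' ((starRingEnd ℂ) z)) :
    HasFDerivAt (fun z : ℂ => f ((starRingEnd ℂ) z))
      (f' • (Complex.conjCLE : ℂ →L[ℝ] ℂ)) z := by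
  have h1 : HasFDerivAt f _ (Complex.conjCLE z) := h.hasFDerivAt.restrictScalars ℝ
  have h2 := h1.comp z Complex.conjCLE.hasFDerivAt
  refine h2.congr_fderiv ?_
  ext w
  simp [mul_comm]

theorem hasFDerivAt_of_hasDerivAt {f : ℂ → ℂ} {f' z : ℂ} (h : HasDerivAt f f' z) :
    HasFDerivAt f (f' • ContinuousLinearMap.id ℝ ℂ) z := by
  refine (h.hasFDerivAt.restrictScalars ℝ).congr_fderiv ?_
  ext w
  simp [mul_comm]

theorem hasFDerivAt_horizPart (N : ℕ) (z : ℂ) :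
    HasFDerivAt (horizPart N) (horizPartDeriv N z) z := by
  have h1 := hasFDerivAt_of_hasDerivAt (hasDerivAt_gaussPrimitive N z)
  have h2 := hasFDerivAt_comp_conj (hasDerivAt_gaussPrimitive N ((starRingEnd ℂ) z))
  have h := (h1.sub h2).const_smul (-(1 / 2) : ℂ)
  refine h.congr_of_eventuallyEq (Eventually.of_forall fun w => ?_)
  simp only [horizPart, Pi.smul_apply, Pi.sub_apply, smul_eq_mul]
  ring

theorem hasFDerivAt_horizPartDeriv_apply (N : ℕ) (z w : ℂ) :
    HasFDerivAt (fun z => horizPartDeriv N z w)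
      ((-(1 / 2) * w : ℂ) • (Complex.I * phaseDeriv N z * gaussMap N z) •
          ContinuousLinearMap.id ℝ ℂ -
        (-(1 / 2) * (starRingEnd ℂ) w : ℂ) •
          (Complex.I * phaseDeriv N ((starRingEnd ℂ) z) * gaussMap N ((starRingEnd ℂ) z)) •
            (Complex.conjCLE : ℂ →L[ℝ] ℂ)) z := by
  have h1 := hasFDerivAt_of_hasDerivAt (hasDerivAt_gaussMap N z)
  have h2 := hasFDerivAt_comp_conj (hasDerivAt_gaussMap N ((starRingEnd ℂ) z))
  have h := (h1.const_smul (-(1 / 2) * w : ℂ)).sub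
    (h2.const_smul (-(1 / 2) * (starRingEnd ℂ) w : ℂ))
  refine h.congr_of_eventuallyEq (Eventually.of_forall fun w => ?_)
  simp only [horizPartDeriv_apply, Pi.smul_apply, Pi.sub_apply, smul_eq_mul]
  ring

/-- The unit complex number `e^{iu}`, where `u = Re h`. -/
def phaseDir (N : ℕ) (z : ℂ) : ℂ := Complex.exp (((phase N z).re : ℂ) * Complex.I)

theorem norm_phaseDir (N : ℕ) (z : ℂ) : ‖phaseDir N z‖ = 1 := Complex.norm_exp_ofReal_mul_I _

theorem phaseDir_ne_zero (N : ℕ) (z : ℂ) : phaseDir N z ≠ 0 := Complex.exp_ne_zero _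

theorem phaseDir_sq_add_sq (N : ℕ) (z : ℂ) :
    (phaseDir N z).re ^ 2 + (phaseDir N z).im ^ 2 = 1 := by
  have h := Complex.normSq_eq_norm_sq (phaseDir N z)
  rw [norm_phaseDir, Complex.normSq_apply] at h
  linarith

theorem gaussMap_eq (N : ℕ) (z : ℂ) : gaussMap N z =
    phaseDir N z * (Real.cosh (phase N z).im - Real.sinh (phase N z).im : ℝ) := by
  rw [Real.cosh_sub_sinh, gaussMap, phaseDir, Complex.ofReal_exp, ← Complex.exp_add]
  congr 1
  apply Complex.ext <;> simp

theorem gaussMap_conj_eq (N : ℕ) (z : ℂ) : gaussMap N ((starRingEnd ℂ) z) =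
    phaseDir N z * (Real.cosh (phase N z).im + Real.sinh (phase N z).im : ℝ) := by
  rw [Real.cosh_add_sinh, gaussMap, phaseDir, Complex.ofReal_exp, ← Complex.exp_add, phase_conj]
  congr 1
  apply Complex.ext <;> simp

theorem horizPartDeriv_one (N : ℕ) (z : ℂ) :
    horizPartDeriv N z 1 = phaseDir N z * Real.sinh (phase N z).im := by
  rw [horizPartDeriv_apply, gaussMap_eq, gaussMap_conj_eq]
  push_cast
  rw [map_one]
  ring

theorem horizPartDeriv_I (N : ℕ) (z : ℂ) :
    horizPartDeriv N z Complex.I =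
      -Complex.I * phaseDir N z * Real.cosh (phase N z).im := by
  rw [horizPartDeriv_apply, gaussMap_eq, gaussMap_conj_eq, Complex.conj_I]
  push_cast
  ring

/-- The inclusion of the horizontal plane, identified with `ℂ`, into space. -/
def planeIncl : ℂ →L[ℝ] R3 :=
  LinearMap.toContinuousLinearMap
    { toFun := fun w => !₂[w.re, w.im, 0]
      map_add' := fun a b => by ext i; fin_cases i <;> simp
      map_smul' := fun r a => by ext i; fin_cases i <;> simp }

/-- The vertical part `z ↦ (0, 0, Re z)` of the Weierstrass representation. -/
def heightPart : ℂ →L[ℝ] R3 :=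
  LinearMap.toContinuousLinearMap
    { toFun := fun w => !₂[0, 0, w.re]
      map_add' := fun a b => by ext i; fin_cases i <;> simp
      map_smul' := fun r a => by ext i; fin_cases i <;> simp }

theorem planeIncl_apply (w : ℂ) : planeIncl w = !₂[w.re, w.im, 0] := rfl

theorem heightPart_apply (w : ℂ) : heightPart w = !₂[0, 0, w.re] := rfl

/-- The conformal minimal immersion with Gauss map `e^{ih}` and height differential `dz`. -/
def surfaceMap (N : ℕ) (z : ℂ) : R3 := planeIncl (horizPart N z) + heightPart z

theorem surfaceMap_zero (N : ℕ) (z : ℂ) : surfaceMap N z 0 = (horizPart N z).re := by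
  simp [surfaceMap, planeIncl_apply, heightPart_apply]

theorem surfaceMap_one (N : ℕ) (z : ℂ) : surfaceMap N z 1 = (horizPart N z).im := by
  simp [surfaceMap, planeIncl_apply, heightPart_apply]

theorem surfaceMap_two (N : ℕ) (z : ℂ) : surfaceMap N z 2 = z.re := by
  simp [surfaceMap, planeIncl_apply, heightPart_apply]

theorem contDiff_surfaceMap (N : ℕ) : ContDiff ℝ ∞ (surfaceMap N) :=
  (planeIncl.contDiff.comp (contDiff_horizPart N)).add heightPart.contDiff

theorem fderiv_surfaceMap (N : ℕ) (z : ℂ) :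
    fderiv ℝ (surfaceMap N) z = planeIncl.comp (horizPartDeriv N z) + heightPart :=
  ((planeIncl.hasFDerivAt.comp z (hasFDerivAt_horizPart N z)).add heightPart.hasFDerivAt).fderiv

theorem fderiv_fderiv_surfaceMap (N : ℕ) (z v w : ℂ) :
    fderiv ℝ (fderiv ℝ (surfaceMap N)) z v w = planeIncl
      (-(Complex.I * phaseDeriv N z * gaussMap N z * (v * w) -
        Complex.I * (starRingEnd ℂ) (phaseDeriv N z) * gaussMap N ((starRingEnd ℂ) z) *
          (starRingEnd ℂ) (v * w)) / 2) := by
  have hc : ContDiff ℝ ∞ (fderiv ℝ (surfaceMap N)) :=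
    (contDiff_infty_iff_fderiv.1 (contDiff_surfaceMap N)).2
  have h1 : HasFDerivAt (fun z => fderiv ℝ (surfaceMap N) z w)
      ((fderiv ℝ (fderiv ℝ (surfaceMap N)) z).flip w) z := by
    have := ((hc.differentiable (by simp)) z).hasFDerivAt.clm_apply (hasFDerivAt_const w z)
    refine this.congr_fderiv ?_
    ext
    simp
  have h2 := (planeIncl.hasFDerivAt.comp z
    (hasFDerivAt_horizPartDeriv_apply N z w)).add_const (heightPart w)
  have h3 : HasFDerivAt (fun z => fderiv ℝ (surfaceMap N) z w) _ z :=
    h2.congr_of_eventuallyEq (Eventually.of_forall fun z => by simp [fderiv_surfaceMap])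
  have h4 := DFunLike.congr_fun (h1.unique h3) v
  rw [ContinuousLinearMap.flip_apply] at h4
  rw [h4, ContinuousLinearMap.comp_apply, phaseDeriv_conj]
  congr 1
  simp
  ring

theorem fderiv_surfaceMap_one (N : ℕ) (z : ℂ) : fderiv ℝ (surfaceMap N) z 1 =
    planeIncl (phaseDir N z * Real.sinh (phase N z).im) + heightPart 1 := by
  rw [fderiv_surfaceMap, add_apply, ContinuousLinearMap.comp_apply,
    horizPartDeriv_one]

theorem fderiv_surfaceMap_I (N : ℕ) (z : ℂ) : fderiv ℝ (surfaceMap N) z Complex.I =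
    planeIncl (-Complex.I * phaseDir N z * Real.cosh (phase N z).im) := by
  rw [fderiv_surfaceMap, add_apply, ContinuousLinearMap.comp_apply,
    horizPartDeriv_I, add_eq_left]
  ext i
  fin_cases i <;> simp [heightPart_apply]

theorem fderiv_surfaceMap_apply (N : ℕ) (z w : ℂ) : fderiv ℝ (surfaceMap N) z w =
    w.re • fderiv ℝ (surfaceMap N) z 1 + w.im • fderiv ℝ (surfaceMap N) z Complex.I := by
  conv_lhs => rw [show w = w.re • (1 : ℂ) + w.im • Complex.I by simp [Complex.re_add_im]]
  rw [map_add, map_smul, map_smul]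

theorem injective_fderiv_surfaceMap (N : ℕ) (z : ℂ) :
    Function.Injective (fderiv ℝ (surfaceMap N) z) := by
  rw [injective_iff_map_eq_zero]
  intro w hw
  have hc := Real.cosh_pos (phase N z).im
  have he := phaseDir_sq_add_sq N z
  rw [fderiv_surfaceMap_apply, fderiv_surfaceMap_one, fderiv_surfaceMap_I] at hw
  have h2 := congrArg (fun p : R3 => p 2) hw
  have h0 := congrArg (fun p : R3 => p 0) hw
  have h1 := congrArg (fun p : R3 => p 1) hw
  simp [planeIncl_apply, heightPart_apply, Complex.sinh_ofReal_re] at h0 h1 h2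
  rw [h2] at h0 h1
  simp only [zero_mul, zero_add, mul_eq_zero, neg_eq_zero, hc.ne', or_false] at h0 h1
  refine Complex.ext h2 ?_
  by_contra hne
  rw [Complex.zero_im] at hne
  simp only [hne, false_or] at h0 h1
  simp [h0, h1] at he

/-- A unit normal of the surface. -/
def unitNormal (N : ℕ) (z : ℂ) : R3 :=
  (Real.cosh (phase N z).im)⁻¹ •
    (planeIncl (phaseDir N z) - Real.sinh (phase N z).im • heightPart 1)

theorem inner_unitNormal_self (N : ℕ) (z : ℂ) :
    inner ℝ (unitNormal N z) (unitNormal N z) = 1 := by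
  have hc := Real.cosh_pos (phase N z).im
  have hcs := Real.cosh_sq (phase N z).im
  have he := phaseDir_sq_add_sq N z
  rw [unitNormal, inner_smul_left, inner_smul_right, PiLp.inner_apply, Fin.sum_univ_three]
  simp [planeIncl_apply, heightPart_apply]
  field_simp
  linear_combination he - hcs

theorem norm_unitNormal (N : ℕ) (z : ℂ) : ‖unitNormal N z‖ = 1 := by
  have h := inner_unitNormal_self N z
  rw [real_inner_self_eq_norm_sq] at h
  exact (pow_eq_one_iff_of_nonneg (norm_nonneg _) two_ne_zero).1 h

theorem unitNormal_mem (N : ℕ) (z : ℂ) : unitNormal N z ∈ (tangentPlane (surfaceMap N) z)ᗮ := by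
  have he := phaseDir_sq_add_sq N z
  rw [Submodule.mem_orthogonal]
  rintro _ ⟨w, rfl⟩
  change inner ℝ (fderiv ℝ (surfaceMap N) z w) _ = 0
  rw [fderiv_surfaceMap_apply, fderiv_surfaceMap_one, fderiv_surfaceMap_I, unitNormal,
    inner_smul_right, PiLp.inner_apply, Fin.sum_univ_three]
  simp [planeIncl_apply, heightPart_apply, Complex.sinh_ofReal_re]
  right
  linear_combination w.re * Real.sinh (phase N z).im * he

theorem normalProjection_planeIncl (N : ℕ) (z : ℂ) (a b : ℝ) :
    (tangentPlane (surfaceMap N) z)ᗮ.starProjection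
        (planeIncl (phaseDir N z * (a * Real.cosh (phase N z).im + b * Complex.I))) =
      a • unitNormal N z := by
  have hc := Real.cosh_pos (phase N z).im
  have hcs := Real.cosh_sq (phase N z).im
  refine Submodule.eq_starProjection_of_mem_orthogonal'
    (Submodule.smul_mem _ _ (unitNormal_mem N z))
    (z := (a * Real.sinh (phase N z).im / Real.cosh (phase N z).im) •
        fderiv ℝ (surfaceMap N) z 1 +
      (-b / Real.cosh (phase N z).im) • fderiv ℝ (surfaceMap N) z Complex.I) ?_ ?_
  · refine Submodule.le_orthogonal_orthogonal _ (Submodule.add_mem _ (Submodule.smul_mem _ _ ?_)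
      (Submodule.smul_mem _ _ ?_)) <;> exact ⟨_, rfl⟩
  · rw [fderiv_surfaceMap_one, fderiv_surfaceMap_I, unitNormal]
    ext i
    fin_cases i
    · simp [planeIncl_apply, heightPart_apply, Complex.sinh_ofReal_re]
      field_simp
      linear_combination a * (phaseDir N z).re * hcs
    · simp [planeIncl_apply, heightPart_apply, Complex.sinh_ofReal_re]
      field_simp
      linear_combination a * (phaseDir N z).im * hcs
    · simp [planeIncl_apply, heightPart_apply, Complex.sinh_ofReal_re]
      field_simp
      ring

theorem secondFundamentalForm_of_mul_eq (N : ℕ) (z : ℂ) (i j : Fin 2) (σ τ : ℝ)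
    (h : paramDir i * paramDir j = σ + τ * Complex.I) :
    secondFundamentalForm (surfaceMap N) z i j =
      (σ * (phaseDeriv N z).im + τ * (phaseDeriv N z).re) • unitNormal N z := by
  rw [secondFundamentalForm, fderiv_fderiv_surfaceMap, h, ← normalProjection_planeIncl N z _
    ((σ * (phaseDeriv N z).re - τ * (phaseDeriv N z).im) * Real.sinh (phase N z).im),
    gaussMap_eq, gaussMap_conj_eq]
  congr 2
  have h1 : phaseDeriv N z = (phaseDeriv N z).re + (phaseDeriv N z).im * Complex.I :=
    (Complex.re_add_im _).symm
  have h2 : (starRingEnd ℂ) (phaseDeriv N z) =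
      (phaseDeriv N z).re - (phaseDeriv N z).im * Complex.I := by
    apply Complex.ext <;> simp
  have h3 : (starRingEnd ℂ) ((σ : ℂ) + τ * Complex.I) = σ - τ * Complex.I := by
    apply Complex.ext <;> simp
  rw [h2, h3]
  generalize (phaseDeriv N z).re = a at *
  generalize (phaseDeriv N z).im = b at *
  rw [h1]
  push_cast
  generalize (Complex.sinh ((phase N z).im : ℂ)) = s
  generalize (Complex.cosh ((phase N z).im : ℂ)) = c
  linear_combination (phaseDir N z * (Complex.I * b * τ * s - (a * τ + b * σ) * c)) *
    Complex.I_sq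

theorem firstFundamentalForm_surfaceMap (N : ℕ) (z : ℂ) :
    firstFundamentalForm (surfaceMap N) z = (Real.cosh (phase N z).im ^ 2) • 1 := by
  have hcs := Real.cosh_sq (phase N z).im
  have he := phaseDir_sq_add_sq N z
  ext i j
  fin_cases i <;> fin_cases j <;>
    simp [firstFundamentalForm, paramDir, fderiv_surfaceMap_one, fderiv_surfaceMap_I,
      PiLp.inner_apply, Fin.sum_univ_three, planeIncl_apply, heightPart_apply,
      Complex.sinh_ofReal_re]
  · linear_combination Real.sinh (phase N z).im ^ 2 * he - hcs
  · ring
  · ring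
  · linear_combination Real.cosh (phase N z).im ^ 2 * he

theorem inv_firstFundamentalForm (N : ℕ) (z : ℂ) :
    (firstFundamentalForm (surfaceMap N) z)⁻¹ = (Real.cosh (phase N z).im ^ 2)⁻¹ • 1 := by
  have hc := Real.cosh_pos (phase N z).im
  refine Matrix.inv_eq_right_inv ?_
  rw [firstFundamentalForm_surfaceMap, smul_mul_smul_comm, mul_one,
    mul_inv_cancel₀ (by positivity), one_smul]

theorem secondFundamentalForm_zero_zero (N : ℕ) (z : ℂ) :
    secondFundamentalForm (surfaceMap N) z 0 0 = (phaseDeriv N z).im • unitNormal N z := by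
  rw [secondFundamentalForm_of_mul_eq N z 0 0 1 0 (by simp [paramDir])]
  simp

theorem secondFundamentalForm_zero_one (N : ℕ) (z : ℂ) :
    secondFundamentalForm (surfaceMap N) z 0 1 = (phaseDeriv N z).re • unitNormal N z := by
  rw [secondFundamentalForm_of_mul_eq N z 0 1 0 1 (by simp [paramDir])]
  simp

theorem secondFundamentalForm_one_zero (N : ℕ) (z : ℂ) :
    secondFundamentalForm (surfaceMap N) z 1 0 = (phaseDeriv N z).re • unitNormal N z := by
  rw [secondFundamentalForm_of_mul_eq N z 1 0 0 1 (by simp [paramDir])]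
  simp

theorem secondFundamentalForm_one_one (N : ℕ) (z : ℂ) :
    secondFundamentalForm (surfaceMap N) z 1 1 = (-(phaseDeriv N z).im) • unitNormal N z := by
  rw [secondFundamentalForm_of_mul_eq N z 1 1 (-1) 0 (by simp [paramDir])]
  simp

theorem meanCurvatureVector_surfaceMap (N : ℕ) (z : ℂ) :
    meanCurvatureVector (surfaceMap N) z = 0 := by
  rw [meanCurvatureVector, inv_firstFundamentalForm]
  simp [Fin.sum_univ_two, secondFundamentalForm_zero_zero, secondFundamentalForm_one_one]

/-- `|A|² = 2 |h'|² / cosh⁴ v`. -/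
theorem sffNormSq_surfaceMap (N : ℕ) (z : ℂ) : sffNormSq (surfaceMap N) z =
    2 * ‖phaseDeriv N z‖ ^ 2 / Real.cosh (phase N z).im ^ 4 := by
  have hc := Real.cosh_pos (phase N z).im
  rw [sffNormSq, inv_firstFundamentalForm, ← Complex.normSq_eq_norm_sq, Complex.normSq_apply]
  simp [Fin.sum_univ_two, secondFundamentalForm_zero_zero, secondFundamentalForm_one_one,
    secondFundamentalForm_zero_one, secondFundamentalForm_one_zero, inner_smul_left,
    inner_smul_right, norm_unitNormal]
  field_simp
  ring

/-! ### Horizontal slices and injectivity of the polar coordinates -/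

/-- A curve whose velocity lies in the cone `|Im| ≤ k Re` has its increments in this cone. -/
theorem abs_im_sub_le_of_deriv_mem_cone {f f' : ℝ → ℂ} {a b k : ℝ} (hab : a ≤ b)
    (hf : ∀ t, HasDerivAt f (f' t) t) (h : ∀ t ∈ Ioo a b, |(f' t).im| ≤ k * (f' t).re) :
    |(f b - f a).im| ≤ k * (f b - f a).re := by
  have aux : ∀ σ : ℝ, |σ| = 1 →
      MonotoneOn (fun t => k * (f t).re + σ * (f t).im) (Icc a b) := by
    intro σ hσ
    have hd : ∀ t, HasDerivAt (fun t => k * (f t).re + σ * (f t).im)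
        (k * (f' t).re + σ * (f' t).im) t := fun t =>
      ((hf t).re_comp.const_mul k).add ((hf t).im_comp.const_mul σ)
    refine monotoneOn_of_deriv_nonneg (convex_Icc a b)
      (fun t _ => (hd t).continuousAt.continuousWithinAt)
      (fun t _ => (hd t).differentiableAt.differentiableWithinAt) fun t ht => ?_
    rw [interior_Icc] at ht
    rw [(hd t).deriv]
    have h1 := h t ht
    have h2 : -(σ * (f' t).im) ≤ |(f' t).im| := by
      rw [← one_mul |(f' t).im|, ← hσ, ← abs_mul]
      exact neg_le_abs _
    linarith
  have h1 := aux 1 (by simp) ⟨le_rfl, hab⟩ ⟨hab, le_rfl⟩ hab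
  have h2 := aux (-1) (by simp) ⟨le_rfl, hab⟩ ⟨hab, le_rfl⟩ hab
  simp only [Complex.sub_im, Complex.sub_re] at *
  rw [abs_le]
  constructor <;> linarith

theorem strictMonoOn_re_of_deriv_pos {f f' : ℝ → ℂ} {a b : ℝ}
    (hf : ∀ t, HasDerivAt f (f' t) t) (h : ∀ t ∈ Ioo a b, 0 < (f' t).re) :
    StrictMonoOn (fun t => (f t).re) (Icc a b) := by
  refine strictMonoOn_of_deriv_pos (convex_Icc a b)
    (fun t _ => (hf t).re_comp.continuousAt.continuousWithinAt) fun t ht => ?_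
  rw [interior_Icc] at ht
  rw [(hf t).re_comp.deriv]
  exact h t ht

theorem hasDerivAt_horizPart_vertical (N : ℕ) (x s : ℝ) :
    HasDerivAt (fun s : ℝ => horizPart N (x + s * Complex.I))
      (-Complex.I * phaseDir N (x + s * Complex.I) *
        Real.cosh (phase N (x + s * Complex.I)).im) s := by
  have h2 : HasDerivAt (fun s : ℝ => (x : ℂ) + s * Complex.I) Complex.I s := by
    simpa using ((hasDerivAt_id s).ofReal_comp.mul_const Complex.I).const_add (x : ℂ)
  rw [← horizPartDeriv_I]
  exact (hasFDerivAt_horizPart N (x + s * Complex.I)).comp_hasDerivAt s h2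

theorem hasDerivAt_horizPart_horizontal (N : ℕ) (t y : ℝ) :
    HasDerivAt (fun t : ℝ => horizPart N (t + y * Complex.I))
      (phaseDir N (t + y * Complex.I) * Real.sinh (phase N (t + y * Complex.I)).im) t := by
  have h2 : HasDerivAt (fun t : ℝ => (t : ℂ) + y * Complex.I) 1 t := by
    simpa using ((hasDerivAt_id t).ofReal_comp).add_const (y * Complex.I)
  rw [← horizPartDeriv_one]
  exact (hasFDerivAt_horizPart N (t + y * Complex.I)).comp_hasDerivAt t h2

theorem exp_mul_phaseDir (N : ℕ) (z : ℂ) (b : ℝ) :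
    Complex.exp (b * Complex.I) * phaseDir N z =
      Complex.exp (((phase N z).re + b : ℝ) * Complex.I) := by
  rw [phaseDir, ← Complex.exp_add]
  push_cast
  ring_nf

/-- A positive multiple of `e^{iψ}` with `0 ≤ ψ ≤ k / 2` lies in the cone `|Im| ≤ k Re`. -/
theorem exp_mul_mem_cone {ψ k r : ℝ} (h0 : 0 ≤ ψ) (hψ : ψ ≤ k / 2) (hk : k ≤ 1) (hr : 0 < r) :
    |(Complex.exp (ψ * Complex.I) * r).im| ≤ k * (Complex.exp (ψ * Complex.I) * r).re ∧
      r / 2 ≤ (Complex.exp (ψ * Complex.I) * r).re := by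
  have hc := Real.one_sub_sq_div_two_le_cos (x := ψ)
  have hs := Real.sin_le h0
  have hs0 : 0 ≤ Real.sin ψ := Real.sin_nonneg_of_nonneg_of_le_pi h0
    (by linarith [Real.pi_gt_three])
  have hc2 : 1 / 2 ≤ Real.cos ψ := by nlinarith
  rw [Complex.re_mul_ofReal, Complex.im_mul_ofReal, Complex.exp_ofReal_mul_I_re,
    Complex.exp_ofReal_mul_I_im, abs_of_nonneg (mul_nonneg hs0 hr.le)]
  constructor
  · rw [← mul_assoc]
    refine mul_le_mul_of_nonneg_right ?_ hr.le
    nlinarith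
  · nlinarith

theorem phase_re_add_mem {N : ℕ} (hN : 0 < N) {x y : ℝ} (hx : x ≤ 1)
    (hy : |y| ≤ 2 * halfWidth N x) :
    (phase N (x + y * Complex.I)).re + expMoment N 0 x ∈ Icc (0 : ℝ) (3 / 50) := by
  have h := phase_re_sub_mem N (x + y * Complex.I)
  have h2 := sq_mul_expMoment_two_le hN hx hy
  simp only [Complex.add_re, Complex.ofReal_re, Complex.mul_re, Complex.I_re, mul_zero,
    Complex.ofReal_im, Complex.I_im, mul_one, sub_self, add_zero, Complex.add_im, Complex.mul_im,
    zero_add] at h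
  exact ⟨h.1, h.2.trans (by linarith)⟩

/-- `horizPart` divided by the direction `-i e^{iu(x)}` in which the horizontal slice at height `x`
leaves the axis. -/
def rotPart (N : ℕ) (z : ℂ) : ℂ :=
  Complex.I * Complex.exp (expMoment N 0 z.re * Complex.I) * horizPart N z

theorem norm_rotPart (N : ℕ) (z : ℂ) : ‖rotPart N z‖ = ‖horizPart N z‖ := by
  rw [rotPart, norm_mul, norm_mul, Complex.norm_I, Complex.norm_exp_ofReal_mul_I, one_mul, one_mul]

theorem hasDerivAt_rot_vertical (N : ℕ) (b x s : ℝ) :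
    HasDerivAt (fun s : ℝ => Complex.I * Complex.exp (b * Complex.I) *
        horizPart N (x + s * Complex.I))
      (Complex.exp (((phase N (x + s * Complex.I)).re + b : ℝ) * Complex.I) *
        Real.cosh (phase N (x + s * Complex.I)).im) s := by
  refine ((hasDerivAt_horizPart_vertical N x s).const_mul
    (Complex.I * Complex.exp (b * Complex.I))).congr_deriv ?_
  rw [← exp_mul_phaseDir]
  linear_combination (-Complex.exp (b * Complex.I) * phaseDir N (x + s * Complex.I) *
    Real.cosh (phase N (x + s * Complex.I)).im) * Complex.I_sq

theorem hasDerivAt_rotPart_vertical (N : ℕ) (x s : ℝ) :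
    HasDerivAt (fun s : ℝ => rotPart N (x + s * Complex.I))
      (Complex.exp (((phase N (x + s * Complex.I)).re + expMoment N 0 x : ℝ) * Complex.I) *
        Real.cosh (phase N (x + s * Complex.I)).im) s := by
  refine (hasDerivAt_rot_vertical N (expMoment N 0 x) x s).congr_of_eventuallyEq
    (Eventually.of_forall fun s => ?_)
  simp [rotPart]

theorem abs_le_of_mem_Ioo {s t a b : ℝ} (h : t ∈ Ioo a b) (ha : -s ≤ a) (hb : b ≤ s) : |t| ≤ s :=
  abs_le.2 ⟨ha.trans h.1.le, h.2.le.trans hb⟩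

theorem rotPart_vertical_cone {N : ℕ} (hN : 0 < N) {x s t : ℝ} (hx : x ≤ 1) (hst : s ≤ t)
    (hs : -(2 * halfWidth N x) ≤ s) (ht : t ≤ 2 * halfWidth N x) :
    |(rotPart N (x + t * Complex.I) - rotPart N (x + s * Complex.I)).im| ≤
      3 / 25 * (rotPart N (x + t * Complex.I) - rotPart N (x + s * Complex.I)).re := by
  refine abs_im_sub_le_of_deriv_mem_cone hst (hasDerivAt_rotPart_vertical N x) fun r hr => ?_
  have h := phase_re_add_mem hN hx (abs_le_of_mem_Ioo hr hs ht)
  exact (exp_mul_mem_cone h.1 (h.2.trans (by norm_num)) (by norm_num) (Real.cosh_pos _)).1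

/-- Every horizontal slice of the surface is a graph over a line. -/
theorem strictMonoOn_rotPart_re {N : ℕ} (hN : 0 < N) {x : ℝ} (hx : x ≤ 1) :
    StrictMonoOn (fun s : ℝ => (rotPart N (x + s * Complex.I)).re)
      (Icc (-(2 * halfWidth N x)) (2 * halfWidth N x)) := by
  refine strictMonoOn_re_of_deriv_pos (hasDerivAt_rotPart_vertical N x) fun r hr => ?_
  have h := phase_re_add_mem hN hx (abs_le_of_mem_Ioo hr le_rfl le_rfl)
  have hc := Real.cosh_pos (phase N (x + r * Complex.I)).im
  exact lt_of_lt_of_le (by positivity)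
    (exp_mul_mem_cone h.1 (h.2.trans (by norm_num)) le_rfl hc).2

theorem rotPart_ofReal (N : ℕ) (x : ℝ) : rotPart N x = 0 := by
  rw [rotPart, horizPart_ofReal, mul_zero]

theorem rotPart_re_pos {N : ℕ} (hN : 0 < N) {x y : ℝ} (hx : x ≤ 1) (h0 : 0 < y)
    (hy : y ≤ 2 * halfWidth N x) : 0 < (rotPart N (x + y * Complex.I)).re := by
  have h := strictMonoOn_rotPart_re hN hx (a := 0) (b := y) ⟨by linarith, by linarith⟩
    ⟨by linarith, hy⟩ h0
  simpa [rotPart_ofReal] using h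

theorem rotPart_cone {N : ℕ} (hN : 0 < N) {x y : ℝ} (hx : x ≤ 1) (h0 : 0 ≤ y)
    (hy : y ≤ 2 * halfWidth N x) : |(rotPart N (x + y * Complex.I)).im| ≤
      3 / 25 * (rotPart N (x + y * Complex.I)).re := by
  have h := rotPart_vertical_cone hN hx h0 (by linarith) hy
  simpa [rotPart_ofReal] using h

theorem norm_horizPart_strictMonoOn {N : ℕ} (hN : 0 < N) {x : ℝ} (hx : x ≤ 1) :
    StrictMonoOn (fun s : ℝ => ‖horizPart N (x + s * Complex.I)‖) (Icc 0 (2 * halfWidth N x)) := by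
  intro s hs t ht hst
  simp only [← norm_rotPart]
  have h1 := rotPart_cone hN hx hs.1 hs.2
  have h2 := rotPart_vertical_cone hN hx hst.le (by linarith [hs.1, hs.2]) ht.2
  have h3 := strictMonoOn_rotPart_re hN hx (a := s) (b := t) ⟨by linarith [hs.1, hs.2], hs.2⟩
    ⟨by linarith [hs.1, hs.2], ht.2⟩ hst
  simp only at h3
  rw [Complex.sub_im, Complex.sub_re] at h2
  rw [abs_le] at h1 h2
  refine lt_of_pow_lt_pow_left₀ 2 (norm_nonneg _) ?_
  rw [← Complex.normSq_eq_norm_sq, ← Complex.normSq_eq_norm_sq, Complex.normSq_apply,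
    Complex.normSq_apply]
  generalize (rotPart N (x + s * Complex.I)).re = a at *
  generalize (rotPart N (x + s * Complex.I)).im = b at *
  generalize (rotPart N (x + t * Complex.I)).re = c at *
  generalize (rotPart N (x + t * Complex.I)).im = d at *
  have ha : 0 ≤ a := by linarith
  have hbd : -(3 / 25 * a * (3 / 25 * (c - a))) ≤ b * (d - b) := by
    have : |b * (d - b)| ≤ 3 / 25 * a * (3 / 25 * (c - a)) := by
      rw [abs_mul]
      exact mul_le_mul (abs_le.2 h1) (abs_le.2 h2) (abs_nonneg _) (by positivity)
    exact (abs_le.1 this).1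
  nlinarith [mul_nonneg ha (sub_nonneg.2 h3.le), mul_pos (sub_pos.2 h3) (sub_pos.2 h3)]

theorem norm_horizPart_le {N : ℕ} (hN : 0 < N) {x y : ℝ} (hx : x ≤ 1) (h0 : 0 ≤ y)
    (hy : y ≤ 2 * halfWidth N x) : ‖horizPart N (x + y * Complex.I)‖ ≤
      y * Real.cosh (phase N (x + y * Complex.I)).im := by
  have h := (convex_Icc 0 y).norm_image_sub_le_of_norm_hasDerivWithin_le
    (f := fun s : ℝ => horizPart N (x + s * Complex.I))
    (C := Real.cosh (phase N (x + y * Complex.I)).im)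
    (fun s _ => (hasDerivAt_horizPart_vertical N x s).hasDerivWithinAt) (fun s hs => by
      rw [norm_mul, norm_mul, norm_neg, Complex.norm_I, norm_phaseDir, one_mul, one_mul,
        Complex.norm_real, Real.norm_of_nonneg (Real.cosh_pos _).le, Real.cosh_le_cosh]
      have h1 := phase_im_ge hN hx hs.1 (hs.2.trans hy)
      have h2 := phase_im_sub_ge hN hx hs.1 hs.2 hy
      have h3 := expMoment_nonneg N 1 x
      have h4 : 0 ≤ expMoment N 1 x / 2 * s := mul_nonneg (by linarith) hs.1
      have h5 : 0 ≤ expMoment N 1 x / 2 * (y - s) :=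
        mul_nonneg (by linarith) (sub_nonneg.2 hs.2)
      rw [abs_of_nonneg (by linarith), abs_of_nonneg (by linarith)]
      linarith)
    (left_mem_Icc.2 h0) (right_mem_Icc.2 h0)
  simpa [horizPart_ofReal, abs_of_nonneg h0, mul_comm] using h

theorem pow_four_div_le_cosh {v : ℝ} (hv : 0 ≤ v) : v ^ 4 / 48 ≤ Real.cosh v := by
  have h := Real.pow_div_factorial_le_exp v hv 4
  have h2 := Real.exp_pos (-v)
  rw [Real.cosh_eq]
  norm_num [Nat.factorial] at h
  linarith

/-- The outer boundary of the slice at height `x` has distance at least a constant multiple of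
`(∑ n e^{-nx})^{1/4}` from the axis: there `v` is about `(∑ n e^{-nx})^{1/4}`, and the speed
`cosh v` of the slice is bounded below by `v⁴ / 48`. -/
theorem le_norm_horizPart_halfWidth {N : ℕ} (hN : 0 < N) {x : ℝ} (hx : x ≤ 1) :
    momentRoot N x / (7680 * 10 ^ 5) ≤ ‖horizPart N (x + halfWidth N x * Complex.I)‖ := by
  have hY := halfWidth_pos hN x
  have hS := expMoment_pos hN 1 x
  set K := expMoment N 1 x ^ 4 / 1536 with hK
  have hd : ∀ s : ℝ, HasDerivAt
      (fun s : ℝ => (rotPart N (x + s * Complex.I)).re - K * s ^ 5 / 5) _ s := fun s =>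
    (hasDerivAt_rotPart_vertical N x s).re_comp.sub
      ((((hasDerivAt_id s).pow 5).const_mul K).div_const 5)
  have hm : MonotoneOn (fun s : ℝ => (rotPart N (x + s * Complex.I)).re - K * s ^ 5 / 5)
      (Icc 0 (halfWidth N x)) := by
    refine monotoneOn_of_deriv_nonneg (convex_Icc _ _)
      (fun t _ => (hd t).continuousAt.continuousWithinAt)
      (fun t _ => (hd t).differentiableAt.differentiableWithinAt) fun s hs => ?_
    rw [interior_Icc] at hs
    rw [(hd s).deriv]
    have h1 := phase_re_add_mem hN hx (abs_le_of_mem_Ioo hs (by linarith)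
      (show halfWidth N x ≤ 2 * halfWidth N x by linarith))
    have hc := Real.cosh_pos (phase N (x + s * Complex.I)).im
    have h2 := (exp_mul_mem_cone h1.1 (h1.2.trans (by norm_num)) le_rfl hc).2
    have h3 := phase_im_ge hN hx hs.1.le (by linarith [hs.2])
    have h4 : 0 ≤ expMoment N 1 x / 2 * s := mul_nonneg (by linarith) hs.1.le
    have h5 := pow_four_div_le_cosh (h4.trans h3)
    have h6 : (expMoment N 1 x / 2 * s) ^ 4 ≤ (phase N (x + s * Complex.I)).im ^ 4 :=
      pow_le_pow_left₀ h4 h3 4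
    have h7 : K * s ^ 4 = (expMoment N 1 x / 2 * s) ^ 4 / 96 := by rw [hK]; ring
    simp only [id]
    refine sub_nonneg.2 (le_trans (b := K * s ^ 4) (le_of_eq ?_) (le_trans ?_ h2))
    · norm_num
      ring
    · linarith
  have h := hm (left_mem_Icc.2 hY.le) (right_mem_Icc.2 hY.le) hY.le
  have h2 := Complex.re_le_norm (rotPart N (x + halfWidth N x * Complex.I))
  rw [norm_rotPart] at h2
  simp [rotPart_ofReal] at h
  refine le_trans (le_of_eq ?_) (h.trans h2)
  have hq := momentRoot_pos hN x
  rw [hK, ← momentRoot_pow_four, halfWidth]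
  field_simp
  norm_num

/-- The part of the parameter plane that is mapped to one of the two multi-valued graphs is
contained in this open set, on which the polar coordinates of `horizPart` are still injective. -/
def upperBand (N : ℕ) : Set ℂ := {z | z.re < 1 ∧ 0 < z.im ∧ z.im < 2 * halfWidth N z.re}

theorem isOpen_upperBand {N : ℕ} (hN : 0 < N) : IsOpen (upperBand N) := by
  have h := (contDiff_halfWidth hN).continuous
  refine (isOpen_lt Complex.continuous_re continuous_const).inter
    ((isOpen_lt continuous_const Complex.continuous_im).inter
      (isOpen_lt Complex.continuous_im ?_))
  exact continuous_const.mul (h.comp Complex.continuous_re)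

theorem rotPart_re_pos_of_mem {N : ℕ} (hN : 0 < N) {z : ℂ} (hz : z ∈ upperBand N) :
    0 < (rotPart N z).re := by
  have h := rotPart_re_pos hN hz.1.le hz.2.1 hz.2.2.le
  rwa [Complex.re_add_im] at h

theorem rotPart_cone_of_mem {N : ℕ} (hN : 0 < N) {z : ℂ} (hz : z ∈ upperBand N) :
    |(rotPart N z).im| ≤ 3 / 25 * (rotPart N z).re := by
  have h := rotPart_cone hN hz.1.le hz.2.1.le hz.2.2.le
  rwa [Complex.re_add_im] at h

/-- The logarithm `log ρ + iθ` of `horizPart`, where `ρ, θ` are polar coordinates and `θ` is the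
branch that is close to `u(x) - π / 2`. -/
def logPart (N : ℕ) (z : ℂ) : ℂ :=
  Complex.log (rotPart N z) - ((expMoment N 0 z.re + Real.pi / 2 : ℝ) : ℂ) * Complex.I

theorem exp_logPart {N : ℕ} (hN : 0 < N) {z : ℂ} (hz : z ∈ upperBand N) :
    Complex.exp (logPart N z) = horizPart N z := by
  have h0 : rotPart N z ≠ 0 := fun h => by
    have := rotPart_re_pos_of_mem hN hz
    simp [h] at this
  have h1 : ((expMoment N 0 z.re + Real.pi / 2 : ℝ) : ℂ) * Complex.I =
      expMoment N 0 z.re * Complex.I + Real.pi / 2 * Complex.I := by push_cast; ring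
  rw [logPart, Complex.exp_sub, Complex.exp_log h0, h1, Complex.exp_add,
    Complex.exp_pi_div_two_mul_I, rotPart]
  have := Complex.exp_ne_zero (expMoment N 0 z.re * Complex.I)
  have := Complex.I_ne_zero
  field_simp

theorem abs_arg_le_of_cone {w : ℂ} {k : ℝ} (h0 : 0 < w.re) (h : |w.im| ≤ k * w.re) :
    |w.arg| ≤ k := by
  have h1 : |w.arg| < Real.pi / 2 := Complex.abs_arg_lt_pi_div_two_iff.2 (Or.inl h0)
  have h2 := Real.le_tan (abs_nonneg w.arg) h1
  refine h2.trans ?_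
  have h3 : Real.tan |w.arg| = |Real.tan w.arg| := by
    rcases abs_cases w.arg with ⟨h4, h5⟩ | ⟨h4, h5⟩
    · rw [h4, abs_of_nonneg]
      rw [h4] at h1
      exact Real.tan_nonneg_of_nonneg_of_le_pi_div_two h5 h1.le
    · rw [h4, Real.tan_neg, abs_of_nonpos]
      rw [h4] at h1
      exact Real.tan_nonpos_of_nonpos_of_neg_pi_div_two_le h5.le (by linarith)
  rw [h3, Complex.tan_arg, abs_div, abs_of_pos h0, div_le_iff₀ h0]
  exact h

/-- Distinct points of the band at whose heights the values of `u` on the axis differ by at most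
`6 / 25` have different horizontal parts. The points are joined by a horizontal and a vertical
segment of the parameter plane. After a common rotation, the image of the former moves within an
angle less than `π / 4` of the direction `1`, that of the latter within the same angle of `∓ i`, so
that the two displacements cannot cancel. -/
theorem eq_of_horizPart_eq {N : ℕ} (hN : 0 < N) {z w : ℂ} (hz : z ∈ upperBand N)
    (hw : w ∈ upperBand N) (hzw : z.re ≤ w.re)
    (hS : expMoment N 0 z.re - expMoment N 0 w.re ≤ 6 / 25)
    (h : horizPart N z = horizPart N w) : z = w := by
  obtain ⟨x₁, y₁⟩ := z
  obtain ⟨x₂, y₂⟩ := w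
  rw [Complex.mk_eq_add_mul_I, Complex.mk_eq_add_mul_I] at h
  obtain ⟨hx₁, hy₁, hyY₁⟩ := hz
  obtain ⟨hx₂, hy₂, hyY₂⟩ := hw
  simp only at *
  set b := expMoment N 0 x₁ with hb
  have hmono := monotone_halfWidth hN
  -- along both segments the direction is `e^{iψ}` up to the rotation, with `0 ≤ ψ ≤ 2 / 5`
  have hψ : ∀ x ∈ Icc x₁ x₂, ∀ y, |y| ≤ 2 * halfWidth N x →
      0 ≤ (phase N (x + y * Complex.I)).re + b ∧
        (phase N (x + y * Complex.I)).re + b ≤ (4 / 5) / 2 := by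
    intro x hx y hy
    have h1 := phase_re_add_mem hN (hx.2.trans hx₂.le) hy
    have h2 := antitone_expMoment N 0 hx.1
    have h3 := antitone_expMoment N 0 hx.2
    constructor <;> linarith [h1.1, h1.2]
  have hvert : ∀ s t : ℝ, 0 < s → s ≤ t → t < 2 * halfWidth N x₂ →
      |(Complex.I * Complex.exp (b * Complex.I) * horizPart N (x₂ + t * Complex.I) -
        Complex.I * Complex.exp (b * Complex.I) * horizPart N (x₂ + s * Complex.I)).im| ≤ 4 / 5 *
      (Complex.I * Complex.exp (b * Complex.I) * horizPart N (x₂ + t * Complex.I) -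
        Complex.I * Complex.exp (b * Complex.I) * horizPart N (x₂ + s * Complex.I)).re := by
    intro s t hs hst ht
    refine abs_im_sub_le_of_deriv_mem_cone hst (hasDerivAt_rot_vertical N b x₂) fun r hr => ?_
    have h := hψ x₂ ⟨hzw, le_rfl⟩ r (abs_le_of_mem_Ioo hr (by linarith) ht.le)
    exact (exp_mul_mem_cone h.1 h.2 (by norm_num) (Real.cosh_pos _)).1
  have hd : ∀ t : ℝ, HasDerivAt (fun t : ℝ => Complex.exp (b * Complex.I) *
      horizPart N (t + y₁ * Complex.I))
      (Complex.exp (((phase N (t + y₁ * Complex.I)).re + b : ℝ) * Complex.I) *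
        Real.sinh (phase N (t + y₁ * Complex.I)).im) t := fun t => by
    refine ((hasDerivAt_horizPart_horizontal N t y₁).const_mul
      (Complex.exp (b * Complex.I))).congr_deriv ?_
    rw [← exp_mul_phaseDir, mul_assoc]
  have hcone : ∀ t ∈ Ioo x₁ x₂,
      |(Complex.exp (((phase N (t + y₁ * Complex.I)).re + b : ℝ) * Complex.I) *
        Real.sinh (phase N (t + y₁ * Complex.I)).im).im| ≤ 4 / 5 *
      (Complex.exp (((phase N (t + y₁ * Complex.I)).re + b : ℝ) * Complex.I) *
        Real.sinh (phase N (t + y₁ * Complex.I)).im).re ∧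
      0 < (Complex.exp (((phase N (t + y₁ * Complex.I)).re + b : ℝ) * Complex.I) *
        Real.sinh (phase N (t + y₁ * Complex.I)).im).re := by
    intro t ht
    have h1 : y₁ ≤ 2 * halfWidth N t := by linarith [hmono ht.1.le]
    have h2 := hψ t ⟨ht.1.le, ht.2.le⟩ y₁ (by rwa [abs_of_pos hy₁])
    have h3 := phase_im_ge hN (ht.2.le.trans hx₂.le) hy₁.le h1
    have h4 : 0 < expMoment N 1 t / 2 * y₁ := mul_pos (by linarith [expMoment_pos hN 1 t]) hy₁
    have h5 := Real.sinh_pos_iff.2 (h4.trans_le h3)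
    have h6 := exp_mul_mem_cone h2.1 h2.2 (by norm_num) h5
    exact ⟨h6.1, by linarith [h6.2]⟩
  have hA := abs_im_sub_le_of_deriv_mem_cone hzw hd fun t ht => (hcone t ht).1
  have hy₁₂ : y₁ < 2 * halfWidth N x₂ := by linarith [hmono hzw]
  -- the horizontal displacement vanishes, as its two components bound each other
  have hx : x₁ = x₂ := by
    by_contra hne
    have hlt : x₁ < x₂ := lt_of_le_of_ne hzw hne
    have hpos := strictMonoOn_re_of_deriv_pos hd (fun t ht => (hcone t ht).2)
      (left_mem_Icc.2 hzw) (right_mem_Icc.2 hzw) hlt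
    simp only at hpos
    rw [h] at hA hpos
    set A := Complex.exp (b * Complex.I) * horizPart N (x₂ + y₁ * Complex.I)
    set B := Complex.exp (b * Complex.I) * horizPart N (x₂ + y₂ * Complex.I)
    have hB : |(A - B).re| ≤ 4 / 5 * |(A - B).im| := by
      rcases le_total y₁ y₂ with hle | hle
      · have := hvert y₁ y₂ hy₁ hle hyY₂
        rw [mul_assoc, mul_assoc] at this
        change |(Complex.I * B - Complex.I * A).im| ≤
          4 / 5 * (Complex.I * B - Complex.I * A).re at this
        simp only [Complex.sub_re, Complex.sub_im, Complex.I_mul_re, Complex.I_mul_im] at this ⊢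
        rw [abs_sub_comm]
        refine this.trans ?_
        have := le_abs_self (A.im - B.im)
        linarith
      · have := hvert y₂ y₁ hy₂ hle hy₁₂
        rw [mul_assoc, mul_assoc] at this
        change |(Complex.I * A - Complex.I * B).im| ≤
          4 / 5 * (Complex.I * A - Complex.I * B).re at this
        simp only [Complex.sub_re, Complex.sub_im, Complex.I_mul_re, Complex.I_mul_im] at this ⊢
        refine this.trans ?_
        have := neg_le_abs (A.im - B.im)
        linarith
    have h1 := le_abs_self (A - B).re
    rw [Complex.sub_re] at *
    linarith
  subst hx
  congr 1
  refine (strictMonoOn_rotPart_re hN hx₁.le).injOn ⟨by linarith, hyY₁.le⟩ ⟨by linarith, hyY₂.le⟩ ?_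
  simp only [rotPart, h]
  simp

theorem injOn_logPart {N : ℕ} (hN : 0 < N) : InjOn (logPart N) (upperBand N) := by
  have key : ∀ z ∈ upperBand N, ∀ w ∈ upperBand N, z.re ≤ w.re → logPart N z = logPart N w →
      z = w := by
    intro z hz w hw hzw h
    refine eq_of_horizPart_eq hN hz hw hzw ?_ (by rw [← exp_logPart hN hz, h, exp_logPart hN hw])
    have h1 := abs_le.1
      (abs_arg_le_of_cone (rotPart_re_pos_of_mem hN hz) (rotPart_cone_of_mem hN hz))
    have h2 := abs_le.1
      (abs_arg_le_of_cone (rotPart_re_pos_of_mem hN hw) (rotPart_cone_of_mem hN hw))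
    have h3 := congrArg Complex.im h
    simp [logPart, Complex.log_im] at h3
    linarith [h1.1, h1.2, h2.1, h2.2]
  intro z hz w hw h
  rcases le_total z.re w.re with hle | hle
  · exact key z hz w hw hle h
  · exact (key w hw z hz hle h.symm).symm

/-! ### The parameter domain -/

/-- The parameter domain `{x + iy : |x| ≤ 1/2, |y| ≤ Y(x)}` of the disk, with `Y` the half-width. -/
def paramDomain (N : ℕ) : Set ℂ := {z | |z.re| ≤ 1 / 2 ∧ |z.im| ≤ halfWidth N z.re}

/-- The homeomorphism `x + iy ↦ x + iy / Y(x)` of the plane, which straightens the parameter domain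
to a rectangle. -/
def straighten {N : ℕ} (hN : 0 < N) : ℂ ≃ₜ ℂ where
  toFun z := ⟨z.re, z.im / halfWidth N z.re⟩
  invFun z := ⟨z.re, z.im * halfWidth N z.re⟩
  left_inv z := Complex.ext rfl (div_mul_cancel₀ _ (halfWidth_pos hN _).ne')
  right_inv z := Complex.ext rfl (mul_div_cancel_right₀ _ (halfWidth_pos hN _).ne')
  continuous_toFun := by
    have h := (contDiff_halfWidth hN).continuous.comp Complex.continuous_re
    exact Complex.equivRealProdCLM.symm.continuous.comp (Complex.continuous_re.prodMk
      (Complex.continuous_im.div h fun z => (halfWidth_pos hN z.re).ne'))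
  continuous_invFun := by
    have h := (contDiff_halfWidth hN).continuous.comp Complex.continuous_re
    exact Complex.equivRealProdCLM.symm.continuous.comp (Complex.continuous_re.prodMk
      (Complex.continuous_im.mul h))

theorem straighten_re {N : ℕ} (hN : 0 < N) (z : ℂ) : (straighten hN z).re = z.re := rfl

theorem straighten_im {N : ℕ} (hN : 0 < N) (z : ℂ) :
    (straighten hN z).im = z.im / halfWidth N z.re := rfl

theorem preimage_straighten {N : ℕ} (hN : 0 < N) :
    straighten hN ⁻¹' (Icc (-(1 / 2)) (1 / 2) ×ℂ Icc (-1) 1) = paramDomain N := by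
  ext z
  have hY := halfWidth_pos hN z.re
  rw [mem_preimage, Complex.mem_reProdIm, straighten_re, straighten_im, paramDomain, mem_ofPred_eq,
    abs_le, abs_le, mem_Icc, mem_Icc, le_div_iff₀ hY, div_le_iff₀ hY, neg_one_mul, one_mul]

theorem convex_rectangle (s t : Set ℝ) (hs : Convex ℝ s) (ht : Convex ℝ t) :
    Convex ℝ (s ×ℂ t) :=
  (hs.linear_preimage Complex.reLm).inter (ht.linear_preimage Complex.imLm)

theorem isCompact_rectangle {a b c d : ℝ} : IsCompact (Icc a b ×ℂ Icc c d) := by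
  exact isCompact_Icc.reProdIm isCompact_Icc

theorem isCompact_paramDomain {N : ℕ} (hN : 0 < N) : IsCompact (paramDomain N) := by
  rw [← preimage_straighten hN]
  exact (straighten hN).isCompact_preimage.2 isCompact_rectangle

theorem nonempty_paramDomain_homeomorph {N : ℕ} (hN : 0 < N) :
    Nonempty (paramDomain N ≃ₜ closedBall (0 : ℂ) 1) := by
  set R : Set ℂ := Icc (-(1 / 2)) (1 / 2) ×ℂ Icc (-1) 1 with hR
  have hcompact : IsCompact R := isCompact_rectangle
  have hint : (interior R).Nonempty := by
    refine ⟨0, ?_⟩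
    rw [hR, Complex.interior_reProdIm, interior_Icc, interior_Icc, Complex.mem_reProdIm]
    norm_num
  obtain ⟨e, -, he, -⟩ := exists_homeomorph_image_interior_closure_frontier_eq_unitBall
    (convex_rectangle _ _ (convex_Icc (-(1 / 2) : ℝ) (1 / 2)) (convex_Icc (-1 : ℝ) 1)) hint
    hcompact.isBounded
  rw [hcompact.isClosed.closure_eq] at he
  refine ⟨((straighten hN).trans e).subtype fun z => ?_⟩
  rw [← he, ← preimage_straighten hN]
  exact (e.injective.mem_set_image (s := R)).symm

theorem mem_frontier_paramDomain {N : ℕ} (hN : 0 < N) (z : ℂ) : z ∈ frontier (paramDomain N) ↔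
    (|z.re| ≤ 1 / 2 ∧ |z.im| = halfWidth N z.re) ∨
      (|z.re| = 1 / 2 ∧ |z.im| ≤ halfWidth N z.re) := by
  have hY := halfWidth_pos hN z.re
  rw [← preimage_straighten hN, ← Homeomorph.preimage_frontier, mem_preimage,
    Complex.frontier_reProdIm, closure_Icc, closure_Icc, frontier_Icc (by norm_num),
    frontier_Icc (by norm_num), mem_union, Complex.mem_reProdIm, Complex.mem_reProdIm,
    straighten_re, straighten_im, abs_le, abs_le, mem_Icc, mem_Icc, le_div_iff₀ hY,
    div_le_iff₀ hY, neg_one_mul, one_mul, mem_insert_iff, mem_singleton_iff, mem_insert_iff,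
    mem_singleton_iff, div_eq_iff hY.ne', div_eq_iff hY.ne', abs_eq hY.le, abs_eq (by norm_num),
    neg_one_mul, one_mul, or_comm (a := z.im = _), or_comm (a := z.re = _)]

/-- A smooth curve on which some linear functional is an affine function of the parameter is a
regular embedded arc. -/
theorem regular_arc {γ : ℝ → ℂ} (hγ : ContDiff ℝ ∞ γ) (l : ℂ →L[ℝ] ℝ) {a b : ℝ} (ha : a ≠ 0)
    (h : ∀ s, l (γ s) = a * s + b) :
    ContDiffOn ℝ ∞ γ (Icc 0 1) ∧ InjOn γ (Icc 0 1) ∧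
      ∀ s ∈ Icc (0 : ℝ) 1, derivWithin γ (Icc 0 1) s ≠ 0 := by
  refine ⟨hγ.contDiffOn, fun s _ t _ hst => ?_, fun s hs h0 => ?_⟩
  · have := congrArg l hst
    rw [h, h] at this
    exact mul_left_cancel₀ ha (add_right_cancel this)
  · have hd : HasDerivAt γ (deriv γ s) s := (hγ.differentiable (by simp) s).hasDerivAt
    rw [hd.hasDerivWithinAt.derivWithin (uniqueDiffOn_Icc zero_lt_one s hs)] at h0
    rw [h0] at hd
    have h1 : HasDerivAt (fun s => l (γ s)) (l 0) s := l.hasFDerivAt.comp_hasDerivAt s hd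
    have h2 : HasDerivAt (fun s => l (γ s)) (a * 1) s := by
      simp only [h]
      exact ((hasDerivAt_id s).const_mul a).add_const b
    have := h1.unique h2
    simp [ha.symm] at this

theorem contDiff_complex_mk {f g : ℝ → ℝ} (hf : ContDiff ℝ ∞ f) (hg : ContDiff ℝ ∞ g) :
    ContDiff ℝ ∞ (fun s => (⟨f s, g s⟩ : ℂ)) :=
  Complex.equivRealProdCLM.symm.contDiff.comp (hf.prodMk hg)

theorem hasPiecewiseSmoothBoundary_paramDomain {N : ℕ} (hN : 0 < N) :
    HasPiecewiseSmoothBoundary (paramDomain N) := by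
  have hY := contDiff_halfWidth hN
  have hid : ContDiff ℝ ∞ (fun s : ℝ => s - 1 / 2) := contDiff_id.sub contDiff_const
  have hseg : ∀ c : ℝ, ContDiff ℝ ∞ (fun s : ℝ => (2 * s - 1) * c) := fun c =>
    ((contDiff_const.mul contDiff_id).sub contDiff_const).mul contDiff_const
  set γ : Fin 4 → ℝ → ℂ := ![fun s => ⟨s - 1 / 2, halfWidth N (s - 1 / 2)⟩,
    fun s => ⟨s - 1 / 2, -halfWidth N (s - 1 / 2)⟩,
    fun s => ⟨1 / 2, (2 * s - 1) * halfWidth N (1 / 2)⟩,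
    fun s => ⟨-(1 / 2), (2 * s - 1) * halfWidth N (-(1 / 2))⟩] with hγ
  refine ⟨4, γ, fun i => ?_, ?_⟩
  · have h1 := halfWidth_pos hN (1 / 2)
    have h2 := halfWidth_pos hN (-(1 / 2))
    fin_cases i
    · exact regular_arc (contDiff_complex_mk hid (hY.comp hid)) Complex.reCLM one_ne_zero
        (b := -(1 / 2)) fun s => by simp [hγ]; ring
    · exact regular_arc (contDiff_complex_mk hid (hY.comp hid).neg) Complex.reCLM one_ne_zero
        (b := -(1 / 2)) fun s => by simp [hγ]; ring
    · exact regular_arc (contDiff_complex_mk contDiff_const (hseg _)) Complex.imCLM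
        (a := 2 * halfWidth N (1 / 2)) (b := -halfWidth N (1 / 2)) (by positivity)
        fun s => by simp [hγ]; ring
    · exact regular_arc (contDiff_complex_mk contDiff_const (hseg _)) Complex.imCLM
        (a := 2 * halfWidth N (-(1 / 2))) (b := -halfWidth N (-(1 / 2))) (by positivity)
        fun s => by simp [hγ]; ring
  · ext ⟨x, y⟩
    have hpos := halfWidth_pos hN x
    have hseg : |y| ≤ halfWidth N x → ∃ s ∈ Icc (0 : ℝ) 1, (2 * s - 1) * halfWidth N x = y := by
      intro h
      rw [abs_le] at h
      refine ⟨(y / halfWidth N x + 1) / 2, ⟨?_, ?_⟩, by field_simp; ring⟩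
      · have : -1 ≤ y / halfWidth N x := by rw [le_div_iff₀ hpos]; linarith
        linarith
      · have : y / halfWidth N x ≤ 1 := by rw [div_le_iff₀ hpos]; linarith
        linarith
    rw [mem_frontier_paramDomain hN, mem_iUnion]
    simp only
    constructor
    · rintro (⟨h1, h2⟩ | ⟨h1, h2⟩)
      · have hx : x + 1 / 2 ∈ Icc (0 : ℝ) 1 := by
          rw [abs_le] at h1; constructor <;> linarith
        rcases (abs_eq hpos.le).1 h2 with rfl | rfl
        · exact ⟨0, x + 1 / 2, hx, by simp [hγ]⟩
        · exact ⟨1, x + 1 / 2, hx, by simp [hγ]⟩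
      · obtain ⟨s, hs, hsy⟩ := hseg h2
        rcases (abs_eq (by norm_num)).1 h1 with rfl | rfl
        · exact ⟨2, s, hs, by simpa [hγ] using hsy⟩
        · exact ⟨3, s, hs, by simpa [hγ] using hsy⟩
    · have habs : ∀ s ∈ Icc (0 : ℝ) 1, ∀ c : ℝ, 0 < c → |(2 * s - 1) * c| ≤ c := by
        intro s hs c hc
        rw [abs_mul, abs_of_pos hc]
        refine mul_le_of_le_one_left hc.le (abs_le.2 ⟨?_, ?_⟩) <;> linarith [hs.1, hs.2]
      rintro ⟨i, s, hs, h⟩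
      have hs' : |s - 1 / 2| ≤ 1 / 2 := abs_le.2 ⟨by linarith [hs.1], by linarith [hs.2]⟩
      fin_cases i <;> simp [hγ] at h <;> obtain ⟨rfl, rfl⟩ := h
      · exact Or.inl ⟨by simpa using hs', by simpa using abs_of_pos hpos⟩
      · exact Or.inl ⟨by simpa using hs', by simpa using abs_of_pos hpos⟩
      · refine Or.inr ⟨by norm_num, ?_⟩
        have := habs s hs _ (halfWidth_pos hN 2⁻¹)
        simpa using this
      · refine Or.inr ⟨by norm_num, ?_⟩
        have := habs s hs _ (halfWidth_pos hN (-2⁻¹))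
        simpa using this

theorem re_le_one_of_mem {N : ℕ} {z : ℂ} (hz : z ∈ paramDomain N) : z.re ≤ 1 := by
  have := (abs_le.1 hz.1).2
  linarith

theorem injOn_surfaceMap {N : ℕ} (hN : 0 < N) : InjOn (surfaceMap N) (paramDomain N) := by
  intro z hz w hw h
  have h2 : z.re = w.re := by simpa only [surfaceMap_two] using congrArg (fun p : R3 => p 2) h
  have hP : horizPart N z = horizPart N w := Complex.ext
    (by simpa only [surfaceMap_zero] using congrArg (fun p : R3 => p 0) h)
    (by simpa only [surfaceMap_one] using congrArg (fun p : R3 => p 1) h)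
  have hx := re_le_one_of_mem hz
  have hz2 := hz.2
  have hw2 := hw.2
  obtain ⟨x, y⟩ := z
  obtain ⟨x', y'⟩ := w
  simp only at h2 hx hz2 hw2
  subst h2
  have hY := halfWidth_pos hN x
  rw [abs_le] at hz2 hw2
  congr 1
  refine (strictMonoOn_rotPart_re hN hx).injOn ⟨by linarith, by linarith⟩
    ⟨by linarith, by linarith⟩ ?_
  rw [Complex.mk_eq_add_mul_I, Complex.mk_eq_add_mul_I] at hP
  simp only [rotPart, hP]
  simp

/-- The compact embedded minimal disk with Gauss map `exp(-i ∑_{n=1}^N e^{-nz})`. -/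
def minimalDisk {N : ℕ} (hN : 0 < N) : CompactEmbeddedDisk where
  domain := paramDomain N
  param := surfaceMap N
  isDisk := nonempty_paramDomain_homeomorph hN
  piecewiseSmooth := hasPiecewiseSmoothBoundary_paramDomain hN
  smooth := ⟨univ, isOpen_univ, subset_univ _, (contDiff_surfaceMap N).contDiffOn⟩
  immersion := fun z _ => injective_fderiv_surfaceMap N z
  injOn := injOn_surfaceMap hN

/-! ### The two multi-valued graphs -/

/-- The inverse of an injective immersion between open sets of the plane is smooth. -/
theorem contDiffAt_invFunOn {f : ℂ → ℂ} {W : Set ℂ} (hW : IsOpen W) (hf : ContDiffOn ℝ ∞ f W)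
    (hinj : InjOn f W) (hd : ∀ z ∈ W, Function.Injective (fderiv ℝ f z)) {w : ℂ}
    (hw : w ∈ f '' W) : ContDiffAt ℝ ∞ (Function.invFunOn f W) w := by
  obtain ⟨z, hz, rfl⟩ := hw
  have hfz : ContDiffAt ℝ ∞ f z := hf.contDiffAt (hW.mem_nhds hz)
  set f' : ℂ ≃L[ℝ] ℂ :=
    (LinearEquiv.ofInjectiveEndo (fderiv ℝ f z).toLinearMap (hd z hz)).toContinuousLinearEquiv
  have hf' : HasFDerivAt f (f' : ℂ →L[ℝ] ℂ) z := by
    refine (hfz.differentiableAt (by simp)).hasFDerivAt.congr_fderiv ?_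
    exact ContinuousLinearMap.ext fun w => rfl
  set e := hfz.toOpenPartialHomeomorph f hf' (by simp)
  have hze : z ∈ e.source := hfz.mem_toOpenPartialHomeomorph_source hf' (by simp)
  have hfe : f z ∈ e.target := hfz.image_mem_toOpenPartialHomeomorph_target hf' (by simp)
  have hsymm : e.symm (f z) = z := e.left_inv hze
  have hsm : ContDiffAt ℝ ∞ e.symm (f z) :=
    e.contDiffAt_symm hfe (by rw [hsymm]; exact hf') (by rw [hsymm]; exact hfz)
  refine hsm.congr_of_eventuallyEq ?_
  have h1 : ∀ᶠ w in 𝓝 (f z), e.symm w ∈ W :=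
    hsm.continuousAt.eventually (by rw [hsymm]; exact hW.mem_nhds hz)
  filter_upwards [h1, e.open_target.mem_nhds hfe] with w hw hwe
  have h2 : f (e.symm w) = w := e.right_inv hwe
  conv_lhs => rw [← h2]
  exact hinj.leftInvOn_invFunOn hw

theorem phase_im_pos {N : ℕ} (hN : 0 < N) {z : ℂ} (hz : z ∈ upperBand N) :
    0 < (phase N z).im := by
  have h := phase_im_ge hN hz.1.le hz.2.1.le hz.2.2.le
  rw [Complex.re_add_im] at h
  have := expMoment_pos hN 1 z.re
  have := hz.2.1
  exact lt_of_lt_of_le (by positivity) h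

theorem horizPartDeriv_injective {N : ℕ} (hN : 0 < N) {z : ℂ} (hz : z ∈ upperBand N) {w : ℂ}
    (h : horizPartDeriv N z w = 0) : w = 0 := by
  have hs := (Real.sinh_pos_iff.2 (phase_im_pos hN hz)).ne'
  have hc := (Real.cosh_pos (phase N z).im).ne'
  have hw : w = w.re • (1 : ℂ) + w.im • Complex.I := by simp [Complex.re_add_im]
  rw [hw, map_add, map_smul, map_smul, horizPartDeriv_one, horizPartDeriv_I] at h
  have h2 : phaseDir N z * (⟨w.re * Real.sinh (phase N z).im,
      -(w.im * Real.cosh (phase N z).im)⟩ : ℂ) = 0 := by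
    rw [← h, Complex.mk_eq_add_mul_I, Complex.real_smul, Complex.real_smul]
    push_cast
    ring
  have h3 := (mul_eq_zero.1 h2).resolve_left (phaseDir_ne_zero N z)
  rw [Complex.ext_iff] at h3
  simp only [Complex.zero_re, Complex.zero_im, mul_eq_zero, neg_eq_zero, hs, hc, or_false] at h3
  exact Complex.ext h3.1 h3.2

theorem contDiff_rotPart (N : ℕ) : ContDiff ℝ ∞ (rotPart N) := by
  have h0 : ContDiff ℝ ∞ (fun z : ℂ => ((expMoment N 0 z.re : ℝ) : ℂ)) :=
    Complex.ofRealCLM.contDiff.comp ((contDiff_expMoment N 0).comp Complex.reCLM.contDiff)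
  exact (contDiff_const.mul (h0.mul contDiff_const).cexp).mul (contDiff_horizPart N)

theorem contDiffAt_logPart {N : ℕ} (hN : 0 < N) {z : ℂ} (hz : z ∈ upperBand N) :
    ContDiffAt ℝ ∞ (logPart N) z := by
  have h0 : ContDiff ℝ ∞ (fun z : ℂ => ((expMoment N 0 z.re + Real.pi / 2 : ℝ) : ℂ)) :=
    Complex.ofRealCLM.contDiff.comp
      (((contDiff_expMoment N 0).comp Complex.reCLM.contDiff).add contDiff_const)
  have h1 : ContDiffAt ℝ ∞ Complex.log (rotPart N z) :=
    (Complex.contDiffAt_log (Or.inl (rotPart_re_pos_of_mem hN hz))).restrict_scalars ℝ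
  exact (h1.comp z (contDiff_rotPart N).contDiffAt).sub (h0.mul contDiff_const).contDiffAt

theorem injective_fderiv_logPart {N : ℕ} (hN : 0 < N) {z : ℂ} (hz : z ∈ upperBand N) :
    Function.Injective (fderiv ℝ (logPart N) z) := by
  rw [injective_iff_map_eq_zero]
  intro w hw
  refine horizPartDeriv_injective hN hz ?_
  have h1 := ((contDiffAt_logPart hN hz).differentiableAt (by simp)).hasFDerivAt.cexp
  have h2 : HasFDerivAt (fun z => Complex.exp (logPart N z)) (horizPartDeriv N z) z := by
    refine (hasFDerivAt_horizPart N z).congr_of_eventuallyEq ?_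
    filter_upwards [(isOpen_upperBand hN).mem_nhds hz] with w hw
    exact exp_logPart hN hw
  rw [h2.unique h1]
  simp [hw]

/-- The inverse of `logPart` on the band. -/
def logInv (N : ℕ) : ℂ → ℂ := Function.invFunOn (logPart N) (upperBand N)

theorem logInv_logPart {N : ℕ} (hN : 0 < N) {z : ℂ} (hz : z ∈ upperBand N) :
    logInv N (logPart N z) = z := (injOn_logPart hN).leftInvOn_invFunOn hz

theorem contDiffAt_logInv {N : ℕ} (hN : 0 < N) {w : ℂ} (hw : w ∈ logPart N '' upperBand N) :
    ContDiffAt ℝ ∞ (logInv N) w :=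
  contDiffAt_invFunOn (isOpen_upperBand hN)
    (fun _ hz => (contDiffAt_logPart hN hz).contDiffWithinAt) (injOn_logPart hN)
    (fun _ hz => injective_fderiv_logPart hN hz) hw

/-- The half of the parameter domain over which the first multi-valued graph lies. -/
def upperHalf (N : ℕ) : Set ℂ := {z | z ∈ paramDomain N ∧ 0 < z.im}

theorem upperHalf_subset {N : ℕ} (hN : 0 < N) : upperHalf N ⊆ upperBand N := by
  rintro z ⟨⟨h1, h2⟩, h3⟩
  have hY := halfWidth_pos hN z.re
  exact ⟨by linarith [(abs_le.1 h1).2], h3, by linarith [(abs_le.1 h2).2]⟩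

theorem isConnected_upperHalf {N : ℕ} (hN : 0 < N) : IsConnected (upperHalf N) := by
  have h : upperHalf N = (straighten hN).symm '' (Icc (-(1 / 2)) (1 / 2) ×ℂ Ioc 0 1) := by
    rw [Homeomorph.image_symm]
    ext z
    have hY := halfWidth_pos hN z.re
    rw [mem_preimage, Complex.mem_reProdIm, straighten_re, straighten_im, upperHalf, mem_ofPred_eq,
      paramDomain, mem_ofPred_eq, abs_le, abs_le, mem_Icc, mem_Ioc, div_le_iff₀ hY, one_mul,
      div_pos_iff_of_pos_right hY]
    constructor
    · rintro ⟨⟨h1, h2⟩, h3⟩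
      exact ⟨h1, h3, h2.2⟩
    · rintro ⟨h1, h2, h3⟩
      exact ⟨⟨h1, by linarith, h3⟩, h2⟩
  rw [h]
  refine IsConnected.image ?_ _ (straighten hN).symm.continuous.continuousOn
  refine ⟨⟨⟨0, 1⟩, ?_⟩, (convex_rectangle _ _ (convex_Icc _ _) (convex_Ioc _ _)).isPreconnected⟩
  rw [Complex.mem_reProdIm]
  norm_num

/-- The polar coordinates `(ρ, θ)` of the horizontal part, in the universal cover. -/
def polarPart (N : ℕ) (z : ℂ) : ℝ × ℝ := (Real.exp (logPart N z).re, (logPart N z).im)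

/-- The logarithm `log ρ + iθ` of a point of the universal cover of the punctured plane. -/
def coverLog (q : ℝ × ℝ) : ℂ := ⟨Real.log q.1, q.2⟩

theorem coverLog_polarPart (N : ℕ) (z : ℂ) : coverLog (polarPart N z) = logPart N z :=
  Complex.ext (Real.log_exp _) rfl

/-- The height of the surface as a function of polar coordinates. -/
def graphHeight (N : ℕ) (q : ℝ × ℝ) : ℝ := (logInv N (coverLog q)).re

theorem polarGraphMap_graphHeight {N : ℕ} (hN : 0 < N) {z : ℂ} (hz : z ∈ upperBand N) :
    polarGraphMap (graphHeight N) (polarPart N z) = surfaceMap N z := by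
  have h := exp_logPart hN hz
  ext i
  fin_cases i
  · change Real.exp (logPart N z).re * Real.cos (logPart N z).im = surfaceMap N z 0
    rw [surfaceMap_zero, ← h, Complex.exp_re]
  · change Real.exp (logPart N z).re * Real.sin (logPart N z).im = surfaceMap N z 1
    rw [surfaceMap_one, ← h, Complex.exp_im]
  · change (logInv N (coverLog (polarPart N z))).re = surfaceMap N z 2
    rw [surfaceMap_two, coverLog_polarPart, logInv_logPart hN hz]

theorem continuousOn_polarPart {N : ℕ} (hN : 0 < N) : ContinuousOn (polarPart N) (upperBand N) := by
  have h : ContinuousOn (logPart N) (upperBand N) := fun z hz =>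
    (contDiffAt_logPart hN hz).continuousAt.continuousWithinAt
  exact (Real.continuous_exp.comp_continuousOn (Complex.continuous_re.comp_continuousOn h)).prodMk
    (Complex.continuous_im.comp_continuousOn h)

theorem contDiffAt_coverInv {N : ℕ} (hN : 0 < N) {q : ℝ × ℝ}
    (hq : q ∈ polarPart N '' upperBand N) :
    ContDiffAt ℝ ∞ (fun q => logInv N (coverLog q)) q := by
  obtain ⟨z, hz, rfl⟩ := hq
  have h1 : ContDiffAt ℝ ∞ coverLog (polarPart N z) :=
    Complex.equivRealProdCLM.symm.contDiff.contDiffAt.comp (polarPart N z)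
      ((contDiffAt_fst.log (Real.exp_pos _).ne').prodMk contDiffAt_snd)
  refine ContDiffAt.comp _ (contDiffAt_logInv hN ?_) h1
  rw [coverLog_polarPart]
  exact ⟨z, hz, rfl⟩

theorem isEmbedding_domRestrict_of_isCompact {X Y : Type*} [TopologicalSpace X]
    [TopologicalSpace Y] [T2Space Y] {f : X → Y} {s K : Set X} (hK : IsCompact K) (hsK : s ⊆ K)
    (hf : Continuous f) (hinj : InjOn f K) : IsEmbedding (s.domRestrict f) := by
  have : CompactSpace K := isCompact_iff_compactSpace.1 hK
  have hc : Continuous (K.domRestrict f) := hf.comp continuous_subtype_val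
  have h := (hc.isClosedEmbedding (injOn_iff_injective.1 hinj)).isEmbedding
  exact h.comp (IsEmbedding.inclusion hsK)

theorem isEmbedding_surfaceMap {N : ℕ} (hN : 0 < N) :
    IsEmbedding ((upperHalf N).domRestrict (surfaceMap N)) :=
  isEmbedding_domRestrict_of_isCompact (isCompact_paramDomain hN) (fun _ hz => hz.1)
    (contDiff_surfaceMap N).continuous (injOn_surfaceMap hN)

theorem isEmbedding_polarGraphMap {N : ℕ} (hN : 0 < N) :
    IsEmbedding ((polarPart N '' upperHalf N).domRestrict (polarGraphMap (graphHeight N))) := by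
  have hsub := upperHalf_subset hN
  have hinv : ∀ z ∈ upperHalf N, logInv N (coverLog (polarPart N z)) = z := fun z hz => by
    rw [coverLog_polarPart, logInv_logPart hN (hsub hz)]
  set ψ : polarPart N '' upperHalf N → upperHalf N := fun q =>
    ⟨logInv N (coverLog q), by
      obtain ⟨_, z, hz, rfl⟩ := q
      simp only
      rwa [hinv z hz]⟩ with hψ
  set φ : upperHalf N → polarPart N '' upperHalf N := fun z => ⟨polarPart N z, z, z.2, rfl⟩ with hφ
  have hφc : Continuous φ := by
    refine Continuous.subtype_mk ?_ _
    exact continuousOn_iff_continuous_domRestrict.1 ((continuousOn_polarPart hN).mono hsub)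
  have hψc : Continuous ψ := by
    refine Continuous.subtype_mk ?_ _
    have hc : ContinuousOn (fun q => logInv N (coverLog q)) (polarPart N '' upperHalf N) :=
      fun q hq => (contDiffAt_coverInv hN (image_mono hsub hq)).continuousAt.continuousWithinAt
    exact continuousOn_iff_continuous_domRestrict.1 hc
  have hleft : Function.LeftInverse φ ψ := by
    rintro ⟨_, z, hz, rfl⟩
    refine Subtype.ext ?_
    simp only [hφ, hψ, hinv z hz]
  have heq : (polarPart N '' upperHalf N).domRestrict (polarGraphMap (graphHeight N)) =
      (upperHalf N).domRestrict (surfaceMap N) ∘ ψ := by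
    funext ⟨_, z, hz, rfl⟩
    simp only [Set.domRestrict_apply, Function.comp_apply, hψ, hinv z hz]
    exact polarGraphMap_graphHeight hN (hsub hz)
  rw [heq]
  exact (isEmbedding_surfaceMap hN).comp (hleft.isEmbedding hφc hψc)

theorem exp_logPart_re {N : ℕ} (hN : 0 < N) {z : ℂ} (hz : z ∈ upperBand N) :
    Real.exp (logPart N z).re = ‖horizPart N z‖ := by
  rw [← exp_logPart hN hz, Complex.norm_exp]

theorem logPart_im_mem {N : ℕ} (hN : 0 < N) {z : ℂ} (hz : z ∈ upperBand N) :
    |(logPart N z).im + (expMoment N 0 z.re + Real.pi / 2)| ≤ 3 / 25 := by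
  have h := abs_arg_le_of_cone (rotPart_re_pos_of_mem hN hz) (rotPart_cone_of_mem hN hz)
  have h2 : (logPart N z).im + (expMoment N 0 z.re + Real.pi / 2) = (rotPart N z).arg := by
    simp [logPart, Complex.log_im]
  rwa [h2]

theorem three_fourths_le_momentRoot {N : ℕ} (hN : 0 < N) {x : ℝ} (hx : x ≤ 1) :
    3 / 4 ≤ momentRoot N x := by
  have h1 := three_fifths_le_momentRoot_sq hN hx
  have h2 := momentRoot_pos hN x
  nlinarith

/-- The radius of a cylinder around the axis that the lateral boundaries of the disks do not
meet. -/
def innerRadius : ℝ := 1 / (2 * (7680 * 10 ^ 5))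

theorem innerRadius_pos : 0 < innerRadius := by norm_num [innerRadius]

theorem innerRadius_lt {N : ℕ} (hN : 0 < N) {x : ℝ} (hx : x ≤ 1) :
    innerRadius < ‖horizPart N (x + halfWidth N x * Complex.I)‖ := by
  have h1 := le_norm_horizPart_halfWidth hN hx
  have h2 := three_fourths_le_momentRoot hN hx
  refine lt_of_lt_of_le ?_ h1
  rw [innerRadius, div_lt_div_iff₀ (by norm_num) (by norm_num)]
  linarith

theorem continuous_norm_horizPart (N : ℕ) (y : ℝ) :
    Continuous fun x : ℝ => ‖horizPart N (x + y * Complex.I)‖ := by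
  have h := (contDiff_horizPart N).continuous
  fun_prop

theorem exists_norm_horizPart_eq {N : ℕ} (hN : 0 < N) {x : ℝ} (hx : x ≤ 1) :
    ∃ y, 0 < y ∧ y < halfWidth N x ∧ ‖horizPart N (x + y * Complex.I)‖ = innerRadius := by
  have hc : Continuous fun y : ℝ => ‖horizPart N (x + y * Complex.I)‖ := by
    have h := (contDiff_horizPart N).continuous
    fun_prop
  have h0 := innerRadius_pos
  obtain ⟨y, hy, h⟩ := intermediate_value_Ioo (halfWidth_pos hN x).le hc.continuousOn
    (show innerRadius ∈ Ioo _ _ from ⟨by simpa [horizPart_ofReal] using h0, innerRadius_lt hN hx⟩)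
  exact ⟨y, hy.1, hy.2, h⟩

/-- The curve in which one half of the surface meets a small cylinder around the axis. -/
theorem exists_continuousAt_cylinder_curve {N : ℕ} (hN : 0 < N) : ∃ f : ℝ → ℝ,
    (∀ x < 1, 0 < f x ∧ f x < halfWidth N x ∧
      ‖horizPart N (x + f x * Complex.I)‖ = innerRadius) ∧ ∀ x < 1, ContinuousAt f x := by
  choose! f hf using fun (x : ℝ) (hx : x < 1) => exists_norm_horizPart_eq hN hx.le
  refine ⟨f, hf, fun x hx => ?_⟩
  have hYc := (contDiff_halfWidth hN).continuous
  have hY := halfWidth_pos hN x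
  obtain ⟨h0, h1, h2⟩ := hf x hx
  have hlt : ∀ᶠ t in 𝓝 x, t < 1 := eventually_lt_nhds hx
  refine tendsto_order.2 ⟨fun a ha => ?_, fun b hb => ?_⟩
  · rcases le_or_gt a 0 with ha0 | ha0
    · filter_upwards [hlt] with t ht
      exact ha0.trans_lt (hf t ht).1
    have h3 : ‖horizPart N (x + a * Complex.I)‖ < innerRadius := by
      rw [← h2]
      exact norm_horizPart_strictMonoOn hN hx.le ⟨ha0.le, by linarith⟩ ⟨h0.le, by linarith⟩ ha
    filter_upwards [hlt, (continuous_norm_horizPart N a).continuousAt.eventually_lt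
      continuousAt_const h3, continuousAt_const.eventually_lt hYc.continuousAt (ha.trans h1)]
      with t ht h4 h5
    obtain ⟨h6, h7, h8⟩ := hf t ht
    have hYt := halfWidth_pos hN t
    rw [← h8] at h4
    exact ((norm_horizPart_strictMonoOn hN ht.le).lt_iff_lt ⟨ha0.le, by linarith⟩
      ⟨h6.le, by linarith⟩).1 h4
  · set c := min b (halfWidth N x) with hc
    have hfc : f x < c := lt_min hb h1
    have h3 : innerRadius < ‖horizPart N (x + c * Complex.I)‖ := by
      rw [← h2]
      exact norm_horizPart_strictMonoOn hN hx.le ⟨h0.le, by linarith⟩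
        ⟨(h0.trans hfc).le, (min_le_right _ _).trans (by linarith)⟩ hfc
    filter_upwards [hlt, continuousAt_const.eventually_lt
      (continuous_norm_horizPart N c).continuousAt h3, continuousAt_const.eventually_lt
      (hYc.const_mul 2 |>.continuousAt) (show c < 2 * halfWidth N x from
        (min_le_right _ _).trans_lt (by linarith))] with t ht h4 h5
    obtain ⟨h6, h7, h8⟩ := hf t ht
    have hYt := halfWidth_pos hN t
    rw [← h8] at h4
    have := ((norm_horizPart_strictMonoOn hN ht.le).lt_iff_lt ⟨h6.le, by linarith⟩
      ⟨(h0.trans hfc).le, h5.le⟩).1 h4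
    exact this.trans_le (min_le_left _ _)

theorem natCast_le_expMoment_sub (N : ℕ) :
    (N : ℝ) ≤ expMoment N 0 (-(1 / 2)) - expMoment N 0 (1 / 2) := by
  rw [expMoment, expMoment, ← Finset.sum_sub_distrib]
  calc (N : ℝ) = ∑ _n ∈ Finset.range N, (1 : ℝ) := by simp
    _ ≤ _ := Finset.sum_le_sum fun n _ => by
      have h1 := Real.self_le_sinh_iff.2 (show (0 : ℝ) ≤ ((n : ℝ) + 1) / 2 by positivity)
      rw [Real.sinh_eq] at h1
      have h2 : (0 : ℝ) ≤ n := n.cast_nonneg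
      rw [show -(((n : ℝ) + 1) * -(1 / 2)) = ((n : ℝ) + 1) / 2 by ring,
        show -(((n : ℝ) + 1) * (1 / 2)) = -(((n : ℝ) + 1) / 2) by ring, pow_zero, one_mul, one_mul]
      linarith

/-- On a small cylinder around the axis the surface makes more than one full turn. -/
theorem exists_two_sheets {N : ℕ} (hN : 10 ≤ N) : ∃ ρ θ : ℝ,
    (ρ, θ) ∈ polarPart N '' upperHalf N ∧ (ρ, θ + 2 * Real.pi) ∈ polarPart N '' upperHalf N := by
  have hN0 : 0 < N := by omega
  obtain ⟨f, hf, hfc⟩ := exists_continuousAt_cylinder_curve hN0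
  set c : ℝ → ℂ := fun x => x + f x * Complex.I with hc
  have hre : ∀ x, (c x).re = x := fun x => by simp [hc]
  have him : ∀ x, (c x).im = f x := fun x => by simp [hc]
  have hmem : ∀ x ∈ Icc (-(1 / 2) : ℝ) (1 / 2), c x ∈ upperHalf N := by
    intro x hx
    obtain ⟨h1, h2, -⟩ := hf x (by linarith [hx.2])
    refine ⟨⟨?_, ?_⟩, ?_⟩
    · rw [hre]
      exact abs_le.2 hx
    · rw [hre, him, abs_of_pos h1]
      exact h2.le
    · rwa [him]
  have hpolar : ∀ x ∈ Icc (-(1 / 2) : ℝ) (1 / 2),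
      polarPart N (c x) = (innerRadius, (logPart N (c x)).im) := by
    intro x hx
    rw [polarPart, exp_logPart_re hN0 (upperHalf_subset hN0 (hmem x hx)),
      (hf x (by linarith [hx.2])).2.2]
  have hcont : ContinuousOn (fun x => (logPart N (c x)).im) (Icc (-(1 / 2)) (1 / 2)) := by
    intro x hx
    have h1 := (contDiffAt_logPart hN0 (upperHalf_subset hN0 (hmem x hx))).continuousAt
    have h2 : ContinuousAt c x := by
      have := hfc x (by linarith [hx.2])
      exact Complex.continuous_ofReal.continuousAt.add
        ((Complex.continuous_ofReal.continuousAt.comp this).mul continuousAt_const)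
    exact (Complex.continuous_im.continuousAt.comp
      (ContinuousAt.comp (g := logPart N) h1 h2)).continuousWithinAt
  have hl : (-(1 / 2) : ℝ) ∈ Icc (-(1 / 2) : ℝ) (1 / 2) := ⟨le_rfl, by norm_num⟩
  have hr : (1 / 2 : ℝ) ∈ Icc (-(1 / 2) : ℝ) (1 / 2) := ⟨by norm_num, le_rfl⟩
  have h1 := abs_le.1 (logPart_im_mem hN0 (upperHalf_subset hN0 (hmem _ hl)))
  have h2 := abs_le.1 (logPart_im_mem hN0 (upperHalf_subset hN0 (hmem _ hr)))
  rw [hre] at h1 h2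
  have h3 := natCast_le_expMoment_sub N
  have h4 : (10 : ℝ) ≤ N := by exact_mod_cast hN
  have h5 := Real.pi_lt_four
  have h6 := Real.pi_pos
  have h7 := Real.pi_lt_d2
  obtain ⟨x, hx, h⟩ := intermediate_value_Icc (by norm_num) hcont
    (show (logPart N (c (-(1 / 2)))).im + 2 * Real.pi ∈ Icc _ _ from
      ⟨by linarith, by linarith [h1.1, h1.2, h2.1, h2.2]⟩)
  refine ⟨innerRadius, (logPart N (c (-(1 / 2)))).im, ⟨_, hmem _ hl, hpolar _ hl⟩,
    ⟨_, hmem x hx, ?_⟩⟩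
  rw [hpolar x hx]
  exact Prod.ext rfl h

theorem isMultivaluedGraph_upper {N : ℕ} (hN : 10 ≤ N) :
    IsMultivaluedGraph (surfaceMap N '' upperHalf N) := by
  have hN0 : 0 < N := by omega
  have hsub := upperHalf_subset hN0
  refine ⟨polarPart N '' upperHalf N, graphHeight N, ?_, ?_, exists_two_sheets hN, ?_,
    isEmbedding_polarGraphMap hN0, ?_⟩
  · rintro _ ⟨z, -, rfl⟩
    exact Real.exp_pos _
  · exact (isConnected_upperHalf hN0).image _ ((continuousOn_polarPart hN0).mono hsub)
  · intro q hq
    exact (Complex.reCLM.contDiff.contDiffAt.comp q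
      (contDiffAt_coverInv hN0 (image_mono hsub hq))).contDiffWithinAt
  · rw [image_image]
    exact image_congr fun z hz => (polarGraphMap_graphHeight hN0 (hsub hz)).symm

/-- The rotation of space by `π` about the `x₃`-axis. -/
def halfTurn : R3 ≃ₜ R3 where
  toFun p := !₂[-p 0, -p 1, p 2]
  invFun p := !₂[-p 0, -p 1, p 2]
  left_inv p := by ext i; fin_cases i <;> simp
  right_inv p := by ext i; fin_cases i <;> simp
  continuous_toFun := by fun_prop
  continuous_invFun := by fun_prop

theorem halfTurn_apply (p : R3) : halfTurn p = !₂[-p 0, -p 1, p 2] := rfl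

/-- The half turn about the axis shifts the angle of a multi-valued graph by `π`. -/
theorem IsMultivaluedGraph.halfTurn {S : Set R3} (hS : IsMultivaluedGraph S) :
    IsMultivaluedGraph (halfTurn '' S) := by
  obtain ⟨Ω, u, hpos, hconn, ⟨ρ, θ, h1, h2⟩, hu, hemb, rfl⟩ := hS
  set τ : ℝ × ℝ → ℝ × ℝ := fun q => (q.1, q.2 - Real.pi) with hτ
  have hτc : Continuous τ := by fun_prop
  have hτd : ContDiff ℝ ∞ τ := contDiff_fst.prodMk (contDiff_snd.sub contDiff_const)
  set σ : ℝ × ℝ → ℝ × ℝ := fun q => (q.1, q.2 + Real.pi) with hσ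
  have hσc : Continuous σ := by fun_prop
  have hστ : ∀ q, σ (τ q) = q := fun q => by simp [hσ, hτ]
  have hτσ : ∀ q, τ (σ q) = q := fun q => by simp [hσ, hτ]
  have hgraph : ∀ q, polarGraphMap (u ∘ τ) q = _root_.halfTurn (polarGraphMap u (τ q)) := by
    intro q
    ext i
    fin_cases i <;> simp [polarGraphMap, halfTurn_apply, hτ, Real.cos_sub_pi, Real.sin_sub_pi]
  have himage : σ '' Ω = τ ⁻¹' Ω := by
    rw [image_eq_preimage_of_inverse hτσ hστ]
  refine ⟨τ ⁻¹' Ω, u ∘ τ, fun q hq => hpos (τ q) hq, ?_, ⟨ρ, θ + Real.pi, ?_, ?_⟩,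
    hu.comp hτd.contDiffOn (mapsTo_preimage _ _), ?_, ?_⟩
  · rw [← himage]
    exact hconn.image _ hσc.continuousOn
  · simpa [hτ] using h1
  · have : τ (ρ, θ + Real.pi + 2 * Real.pi) = (ρ, θ + 2 * Real.pi) :=
      Prod.ext rfl (by simp only [hτ]; ring)
    rwa [mem_preimage, this]
  · have hτe : IsEmbedding (fun q : τ ⁻¹' Ω => (⟨τ q, q.2⟩ : Ω)) := by
      refine Function.LeftInverse.isEmbedding
        (f := fun q : Ω => (⟨σ q, by rw [mem_preimage, hτσ]; exact q.2⟩ : τ ⁻¹' Ω))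
        (fun q => Subtype.ext (hστ q)) ?_ ?_
      · exact (hσc.comp continuous_subtype_val).subtype_mk _
      · exact (hτc.comp continuous_subtype_val).subtype_mk _
    have h := _root_.halfTurn.isEmbedding.comp (hemb.comp hτe)
    convert h using 1
    funext q
    exact hgraph q
  · rw [← himage, image_image, image_image]
    refine image_congr fun q _ => ?_
    rw [hgraph, hτσ]

theorem surfaceMap_conj (N : ℕ) (z : ℂ) :
    surfaceMap N ((starRingEnd ℂ) z) = halfTurn (surfaceMap N z) := by
  ext i
  rw [halfTurn_apply]
  fin_cases i
  · simp [surfaceMap_zero, horizPart_conj]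
  · simp [surfaceMap_one, horizPart_conj]
  · simp [surfaceMap_two]

/-! ### Curvature and boundary of the disks -/

theorem normSqA_minimalDisk {N : ℕ} (hN : 0 < N) {z : ℂ} (hz : z ∈ paramDomain N) :
    (minimalDisk hN).normSqA (surfaceMap N z) = sffNormSq (surfaceMap N) z := by
  have h : Function.invFunOn (surfaceMap N) (paramDomain N) (surfaceMap N z) = z :=
    (injOn_surfaceMap hN).leftInvOn_invFunOn hz
  exact congrArg (sffNormSq (surfaceMap N)) h

theorem surfaceMap_ofReal (N : ℕ) (x : ℝ) : surfaceMap N x = heightPart x := by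
  rw [surfaceMap, horizPart_ofReal, map_zero, zero_add]

theorem eq_surfaceMap_of_mem_axisSegment (N : ℕ) {a b : ℝ} {p : R3} (hp : p ∈ axisSegment a b) :
    p = surfaceMap N (p 2 : ℝ) := by
  obtain ⟨h0, h1, -⟩ := hp
  rw [surfaceMap_ofReal, heightPart_apply]
  ext i
  fin_cases i
  · simpa using h0
  · simpa using h1
  · simp

theorem ofReal_mem_paramDomain {N : ℕ} (hN : 0 < N) {x : ℝ} (hx : |x| ≤ 1 / 2) :
    (x : ℂ) ∈ paramDomain N :=
  ⟨by simpa using hx, by simpa using (halfWidth_pos hN x).le⟩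

theorem conj_mem_paramDomain {N : ℕ} {z : ℂ} (hz : z ∈ paramDomain N) :
    (starRingEnd ℂ) z ∈ paramDomain N := by
  simpa [paramDomain] using hz

theorem surfaceMap_mem_axisSegment_iff {N : ℕ} (hN : 0 < N) {z : ℂ} (hz : z ∈ paramDomain N) :
    surfaceMap N z ∈ axisSegment (-1 / 2) (1 / 2) ↔ z.im = 0 := by
  constructor
  · intro h
    have h2 := eq_surfaceMap_of_mem_axisSegment N h
    rw [surfaceMap_two] at h2
    rw [injOn_surfaceMap hN hz (ofReal_mem_paramDomain hN hz.1) h2, Complex.ofReal_im]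
  · intro h
    have hz' : z = (z.re : ℝ) := Complex.ext rfl (by simpa using h)
    have h1 := abs_le.1 hz.1
    rw [hz', surfaceMap_ofReal, heightPart_apply]
    refine ⟨by simp, by simp, ?_, ?_⟩
    · simp; linarith
    · simp; linarith

theorem minimalDisk_diff_axisSegment {N : ℕ} (hN : 0 < N) :
    (minimalDisk hN).carrier \ axisSegment (-1 / 2) (1 / 2) =
      surfaceMap N '' upperHalf N ∪ halfTurn '' (surfaceMap N '' upperHalf N) := by
  apply Subset.antisymm
  · rintro _ ⟨⟨z, hz, rfl⟩, h⟩
    have hz0 : z.im ≠ 0 := fun h0 => h ((surfaceMap_mem_axisSegment_iff hN hz).2 h0)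
    rcases lt_or_gt_of_ne hz0 with h0 | h0
    · refine Or.inr ⟨_, ⟨(starRingEnd ℂ) z, ⟨conj_mem_paramDomain hz, by simpa using h0⟩, rfl⟩, ?_⟩
      rw [← surfaceMap_conj, Complex.conj_conj]
      rfl
    · exact Or.inl ⟨z, ⟨hz, h0⟩, rfl⟩
  · rintro _ (⟨z, ⟨hz, h0⟩, rfl⟩ | ⟨_, ⟨z, ⟨hz, h0⟩, rfl⟩, rfl⟩)
    · exact ⟨⟨z, hz, rfl⟩, fun h => h0.ne' ((surfaceMap_mem_axisSegment_iff hN hz).1 h)⟩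
    · have hz' := conj_mem_paramDomain hz
      rw [← surfaceMap_conj]
      refine ⟨⟨_, hz', rfl⟩, fun h => h0.ne' ?_⟩
      simpa using (surfaceMap_mem_axisSegment_iff hN hz').1 h

theorem disjoint_halves {N : ℕ} (hN : 0 < N) :
    Disjoint (surfaceMap N '' upperHalf N) (halfTurn '' (surfaceMap N '' upperHalf N)) := by
  rw [Set.disjoint_left]
  rintro _ ⟨z, ⟨hz, h0⟩, rfl⟩ ⟨_, ⟨w, ⟨hw, h1⟩, rfl⟩, h⟩
  rw [← surfaceMap_conj] at h
  have := injOn_surfaceMap hN (conj_mem_paramDomain hw) hz h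
  rw [← this, Complex.conj_im] at h0
  linarith

theorem natCast_le_expMoment_one (N : ℕ) {x : ℝ} (hx : x ≤ 0) : (N : ℝ) ≤ expMoment N 1 x := by
  calc (N : ℝ) = ∑ _n ∈ Finset.range N, (1 : ℝ) := by simp
    _ ≤ _ := Finset.sum_le_sum fun n _ => by
      have h1 : (0 : ℝ) ≤ n := n.cast_nonneg
      have h2 : 1 ≤ Real.exp (-(((n : ℝ) + 1) * x)) :=
        Real.one_le_exp (by nlinarith)
      rw [pow_one]
      nlinarith

theorem sffNormSq_ofReal (N : ℕ) (x : ℝ) :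
    sffNormSq (surfaceMap N) x = 2 * expMoment N 1 x ^ 2 := by
  rw [sffNormSq_surfaceMap, phase_ofReal, phaseDeriv_ofReal]
  simp

theorem sffNormSq_conj (N : ℕ) (z : ℂ) :
    sffNormSq (surfaceMap N) ((starRingEnd ℂ) z) = sffNormSq (surfaceMap N) z := by
  rw [sffNormSq_surfaceMap, sffNormSq_surfaceMap, phase_conj, phaseDeriv_conj, RCLike.norm_conj,
    Complex.conj_im, Real.cosh_neg]

theorem sffNormSq_le_expMoment (N : ℕ) (z : ℂ) :
    sffNormSq (surfaceMap N) z ≤ 2 * expMoment N 1 z.re ^ 2 / Real.cosh (phase N z).im ^ 4 := by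
  have := Real.cosh_pos (phase N z).im
  rw [sffNormSq_surfaceMap]
  gcongr
  exact norm_phaseDeriv_le N z

/-- Away from the axis the curvature is bounded: a slice of length at most `Y cosh v` that reaches
the distance `ρ` must have `cosh v ≥ ρ / Y`. -/
theorem sffNormSq_le_of_le_norm {N : ℕ} (hN : 0 < N) {z : ℂ} (hz : z ∈ paramDomain N) {ρ : ℝ}
    (hρ : 0 < ρ) (h : ρ ≤ ‖horizPart N z‖) : sffNormSq (surfaceMap N) z ≤ 2 / ρ ^ 4 := by
  wlog h0 : 0 ≤ z.im generalizing z
  · have := this (conj_mem_paramDomain hz) (by rwa [horizPart_conj, norm_neg])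
      (by rw [Complex.conj_im]; linarith)
    rwa [sffNormSq_conj] at this
  have hx := re_le_one_of_mem hz
  have hY := halfWidth_pos hN z.re
  have hy := hz.2
  rw [abs_of_nonneg h0] at hy
  have h1 := norm_horizPart_le hN hx h0 (by linarith)
  rw [Complex.re_add_im] at h1
  have hc := Real.cosh_pos (phase N z).im
  have hS := expMoment_pos hN 1 z.re
  have hq := three_fourths_le_momentRoot hN hx
  have h2 : ρ ≤ halfWidth N z.re * Real.cosh (phase N z).im :=
    h.trans (h1.trans (by gcongr))
  have h3 : ρ ^ 4 ≤ (halfWidth N z.re * Real.cosh (phase N z).im) ^ 4 := by gcongr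
  have h4 : expMoment N 1 z.re ^ 2 * halfWidth N z.re ^ 4 ≤ 1 := by
    have h5 := halfWidth_mul_momentRoot hN z.re
    have h6 : (halfWidth N z.re * momentRoot N z.re ^ 3) ^ 4 =
        expMoment N 1 z.re ^ 2 * halfWidth N z.re ^ 4 * momentRoot N z.re ^ 4 := by
      rw [← momentRoot_pow_four]; ring
    have h7 : (3 / 4 : ℝ) ^ 4 ≤ momentRoot N z.re ^ 4 := by gcongr
    rw [h5] at h6
    by_contra hlt
    rw [not_le] at hlt
    nlinarith
  refine (sffNormSq_le_expMoment N z).trans ?_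
  rw [div_le_div_iff₀ (by positivity) (by positivity)]
  calc 2 * expMoment N 1 z.re ^ 2 * ρ ^ 4
      ≤ 2 * expMoment N 1 z.re ^ 2 * (halfWidth N z.re * Real.cosh (phase N z).im) ^ 4 := by
        gcongr
    _ = 2 * (expMoment N 1 z.re ^ 2 * halfWidth N z.re ^ 4) * Real.cosh (phase N z).im ^ 4 := by
        ring
    _ ≤ 2 * 1 * Real.cosh (phase N z).im ^ 4 := by gcongr
    _ = _ := by ring

theorem expMoment_one_le_tsum (N : ℕ) {x : ℝ} (hx : 0 < x) :
    expMoment N 1 x ≤ ∑' n : ℕ, (n : ℝ) ^ 1 * Real.exp (-x * n) := by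
  rw [expMoment_eq_sum_range_succ N 1 one_ne_zero]
  have h := (Real.summable_pow_mul_exp_neg_nat_mul 1 hx).sum_le_tsum (Finset.range (N + 1))
    fun n _ => by positivity
  refine le_trans (le_of_eq (Finset.sum_congr rfl fun n _ => ?_)) h
  rw [← Real.exp_nat_mul]
  ring_nf

theorem norm_planeIncl (w : ℂ) : ‖planeIncl w‖ = ‖w‖ := by
  rw [planeIncl_apply, EuclideanSpace.norm_eq, Complex.norm_def, Complex.normSq_apply,
    Fin.sum_univ_three]
  congr 1
  simp [sq_abs]
  ring

theorem norm_heightPart_ofReal (x : ℝ) : ‖heightPart x‖ = |x| := by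
  rw [heightPart_apply, EuclideanSpace.norm_eq, Fin.sum_univ_three]
  simp [Real.sqrt_sq_eq_abs]

theorem heightPart_mem_axisSegment {a b t : ℝ} (ht : t ∈ Icc a b) :
    heightPart t ∈ axisSegment a b := by
  rw [heightPart_apply]
  exact ⟨by simp, by simp, by simpa using ht⟩

theorem surfaceMap_mem_thickening {N : ℕ} {z : ℂ} (hz : z ∈ paramDomain N) {δ : ℝ} (hδ : 0 < δ)
    (hx : z.re ≤ δ / 2) (h : ‖horizPart N z‖ < δ / 2) :
    surfaceMap N z ∈ thickening δ (axisSegment (-1 / 2) 0) := by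
  have h1 := abs_le.1 hz.1
  rw [mem_thickening_iff]
  refine ⟨heightPart (min z.re 0 : ℝ), heightPart_mem_axisSegment
    ⟨le_min (by linarith) (by norm_num), min_le_right _ _⟩, ?_⟩
  have h2 : surfaceMap N z - heightPart (min z.re 0 : ℝ) =
      planeIncl (horizPart N z) + heightPart (z.re - min z.re 0 : ℝ) := by
    have h3 : heightPart z = heightPart (z.re : ℝ) := rfl
    rw [surfaceMap, h3, Complex.ofReal_sub, map_sub]
    abel
  have h3 : |z.re - min z.re 0| ≤ δ / 2 := by
    rcases min_cases z.re 0 with ⟨h4, h5⟩ | ⟨h4, h5⟩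
    · rw [h4, sub_self, abs_zero]
      linarith
    · rw [h4, sub_zero, abs_of_pos h5]
      exact hx
  rw [dist_eq_norm, h2]
  refine (norm_add_le _ _).trans_lt ?_
  rw [norm_planeIncl, norm_heightPart_ofReal]
  linarith

/-- The curvature bound outside a neighbourhood of the segment: to the right of the origin the
moments `∑ n e^{-nx}` are bounded, elsewhere the point is away from the axis. -/
theorem exists_sffNormSq_le {δ : ℝ} (hδ : 0 < δ) : ∃ C : ℝ, ∀ N : ℕ, 0 < N → ∀ z ∈ paramDomain N,
    surfaceMap N z ∉ thickening δ (axisSegment (-1 / 2) 0) → sffNormSq (surfaceMap N) z ≤ C := by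
  set T := ∑' n : ℕ, (n : ℝ) ^ 1 * Real.exp (-(δ / 2) * n) with hT
  refine ⟨max (2 * T ^ 2) (2 / (δ / 2) ^ 4), fun N hN z hz h => ?_⟩
  rcases le_or_gt z.re (δ / 2) with hx | hx
  · refine le_max_of_le_right (sffNormSq_le_of_le_norm hN hz (by positivity) ?_)
    by_contra hlt
    exact h (surfaceMap_mem_thickening hz hδ hx (not_le.1 hlt))
  · refine le_max_of_le_left ((sffNormSq_le_expMoment N z).trans ?_)
    have h1 := expMoment_nonneg N 1 z.re
    have h2 := (antitone_expMoment N 1 hx.le).trans (expMoment_one_le_tsum N (half_pos hδ))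
    calc 2 * expMoment N 1 z.re ^ 2 / Real.cosh (phase N z).im ^ 4
        ≤ 2 * expMoment N 1 z.re ^ 2 := by
          refine div_le_self (by positivity) (one_le_pow₀ (Real.one_le_cosh _))
      _ ≤ 2 * T ^ 2 := by gcongr

theorem sq_add_sq_surfaceMap (N : ℕ) (z : ℂ) :
    surfaceMap N z 0 ^ 2 + surfaceMap N z 1 ^ 2 = ‖horizPart N z‖ ^ 2 := by
  rw [surfaceMap_zero, surfaceMap_one, ← Complex.normSq_eq_norm_sq, Complex.normSq_apply]
  ring

theorem axisDist_surfaceMap (N : ℕ) (z : ℂ) : axisDist (surfaceMap N z) = ‖horizPart N z‖ := by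
  rw [axisDist, sq_add_sq_surfaceMap, Real.sqrt_sq (norm_nonneg _)]

theorem norm_horizPart_of_abs_im_eq {N : ℕ} (hN : 0 < N) {z : ℂ}
    (hz : |z.im| = halfWidth N z.re) :
    ‖horizPart N z‖ = ‖horizPart N (z.re + halfWidth N z.re * Complex.I)‖ := by
  rcases (abs_eq (halfWidth_pos hN _).le).1 hz with h | h
  · rw [← h, Complex.re_add_im]
  · rw [← norm_neg, ← horizPart_conj]
    congr 2
    apply Complex.ext <;> simp [h]

theorem disjoint_boundary_cylinder {N : ℕ} (hN : 0 < N) : Disjoint (minimalDisk hN).boundary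
    {p | p 0 ^ 2 + p 1 ^ 2 ≤ innerRadius ^ 2 ∧ -1 / 2 < p 2 ∧ p 2 < 1 / 2} := by
  rw [Set.disjoint_left]
  rintro _ ⟨z, hz, rfl⟩ ⟨h1, h2, h3⟩
  change surfaceMap N z 0 ^ 2 + surfaceMap N z 1 ^ 2 ≤ _ at h1
  change _ < surfaceMap N z 2 at h2
  change surfaceMap N z 2 < _ at h3
  rw [surfaceMap_two] at h2 h3
  rw [sq_add_sq_surfaceMap] at h1
  rcases (mem_frontier_paramDomain hN z).1 hz with ⟨-, h⟩ | ⟨h, -⟩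
  · rw [norm_horizPart_of_abs_im_eq hN h] at h1
    exact absurd (le_of_sq_le_sq h1 innerRadius_pos.le)
      (not_le.2 (innerRadius_lt hN (by linarith)))
  · rcases (abs_eq (by norm_num)).1 h with h | h <;> linarith

theorem lateralBoundary_subset {N : ℕ} (hN : 0 < N) : (minimalDisk hN).lateralBoundary ⊆
    surfaceMap N '' {z | z ∈ paramDomain N ∧ |z.im| = halfWidth N z.re} := by
  have hY := (contDiff_halfWidth hN).continuous
  have hcl : IsClosed {z : ℂ | |z.im| = halfWidth N z.re} :=
    isClosed_eq (continuous_abs.comp Complex.continuous_im) (hY.comp Complex.continuous_re)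
  have hK : IsCompact (paramDomain N ∩ {z : ℂ | |z.im| = halfWidth N z.re}) :=
    (isCompact_paramDomain hN).inter_right hcl
  refine closure_minimal ?_ (hK.image (contDiff_surfaceMap N).continuous).isClosed
  rintro _ ⟨⟨z, hz, rfl⟩, h⟩
  change |surfaceMap N z 2| < 1 / 2 at h
  rw [surfaceMap_two] at h
  rcases (mem_frontier_paramDomain hN z).1 hz with ⟨h1, h2⟩ | ⟨h1, -⟩
  · exact ⟨z, ⟨⟨h1, h2.le⟩, h2⟩, rfl⟩
  · exact absurd h1 h.ne

theorem mem_lateralBoundary {N : ℕ} (hN : 0 < N) {t : ℝ} (ht : t ∈ Icc (-(1 / 2) : ℝ) (1 / 2)) :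
    surfaceMap N (t + halfWidth N t * Complex.I) ∈ (minimalDisk hN).lateralBoundary := by
  have hY := (contDiff_halfWidth hN).continuous
  have hF := (contDiff_surfaceMap N).continuous
  have hc : Continuous fun t : ℝ => surfaceMap N (t + halfWidth N t * Complex.I) :=
    hF.comp (Complex.continuous_ofReal.add
      ((Complex.continuous_ofReal.comp hY).mul continuous_const))
  rw [← closure_Ioo (by norm_num)] at ht
  refine map_mem_closure (f := fun t : ℝ => surfaceMap N (t + halfWidth N t * Complex.I)) hc ht
    fun s hs => ⟨⟨_, ?_, rfl⟩, ?_⟩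
  · refine (mem_frontier_paramDomain hN _).2 (Or.inl ⟨?_, ?_⟩)
    · simpa using abs_le.2 ⟨hs.1.le, hs.2.le⟩
    · simpa using (halfWidth_pos hN s).le
  · change |surfaceMap N (s + halfWidth N s * Complex.I) 2| < 1 / 2
    rw [surfaceMap_two]
    simpa using abs_lt.2 hs

theorem le_sInf_axisDist {N : ℕ} (hN : 0 < N) {t : ℝ} (ht : t ∈ Icc (-(1 / 2) : ℝ) (1 / 2)) :
    momentRoot N t / (7680 * 10 ^ 5) ≤
      sInf (axisDist '' ((minimalDisk hN).lateralBoundary ∩ {p | p 2 = t})) := by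
  have hne : surfaceMap N (t + halfWidth N t * Complex.I) ∈
      (minimalDisk hN).lateralBoundary ∩ {p | p 2 = t} :=
    ⟨mem_lateralBoundary hN ht, by
      change surfaceMap N (t + halfWidth N t * Complex.I) 2 = t
      simp [surfaceMap_two]⟩
  refine le_csInf ⟨_, mem_image_of_mem _ hne⟩ ?_
  rintro _ ⟨p, ⟨hp, hpt⟩, rfl⟩
  obtain ⟨z, ⟨-, hz⟩, rfl⟩ := lateralBoundary_subset hN hp
  have hre : z.re = t := by
    rw [← hpt, surfaceMap_two]
  rw [axisDist_surfaceMap, norm_horizPart_of_abs_im_eq hN hz, hre]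
  exact le_norm_horizPart_halfWidth hN (by linarith [ht.2])

theorem theorem1 :
    ∃ M : ℕ → CompactEmbeddedDisk,
      (∀ N, (M N).IsMinimal ∧
        (M N).carrier ⊆ {p | p 2 ∈ Icc (-1 / 2 : ℝ) (1 / 2)} ∧
        axisSegment (-1 / 2) (1 / 2) ⊆ (M N).carrier) ∧
      (∀ p ∈ axisSegment (-1 / 2) 0,
        Tendsto (fun N => (M N).normSqA p) atTop atTop) ∧
      (∀ N, ∃ M₁ M₂ : Set R3, IsMultivaluedGraph M₁ ∧ IsMultivaluedGraph M₂ ∧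
        Disjoint M₁ M₂ ∧ (M N).carrier \ axisSegment (-1 / 2) (1 / 2) = M₁ ∪ M₂) ∧
      (∀ δ : ℝ, 0 < δ → ∃ C : ℝ, ∀ N,
        ∀ p ∈ (M N).carrier \ thickening δ (axisSegment (-1 / 2) 0), (M N).normSqA p ≤ C) ∧
      (∃ r₀ : ℝ, 0 < r₀ ∧ ∀ N, Disjoint (M N).boundary
        {p | p 0 ^ 2 + p 1 ^ 2 ≤ r₀ ^ 2 ∧ -1 / 2 < p 2 ∧ p 2 < 1 / 2}) ∧
      (∀ t ∈ Icc (-1 / 2 : ℝ) 0,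
        Tendsto (fun N => sInf (axisDist '' ((M N).lateralBoundary ∩ {p | p 2 = t})))
          atTop atTop) := by
  -- ten exponentials suffice for more than a full turn on a small cylinder around the axis
  have hpos : ∀ N : ℕ, 0 < N + 10 := fun N => by omega
  have hcast : Tendsto (fun N : ℕ => ((N + 10 : ℕ) : ℝ)) atTop atTop :=
    tendsto_natCast_atTop_atTop.comp (tendsto_add_atTop_nat 10)
  refine ⟨fun N => minimalDisk (hpos N), fun N => ⟨fun z _ => ?_, ?_, fun p hp => ?_⟩,
    fun p hp => ?_, fun N => ?_, fun δ hδ => ?_, ⟨innerRadius, innerRadius_pos, fun N =>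
      disjoint_boundary_cylinder (hpos N)⟩, fun t ht => ?_⟩
  · exact meanCurvatureVector_surfaceMap _ z
  · rintro _ ⟨z, hz, rfl⟩
    change surfaceMap (N + 10) z 2 ∈ Icc (-1 / 2 : ℝ) (1 / 2)
    have := abs_le.1 hz.1
    rw [surfaceMap_two]
    constructor <;> linarith
  · rw [eq_surfaceMap_of_mem_axisSegment (N + 10) hp]
    exact ⟨_, ofReal_mem_paramDomain (hpos N)
      (abs_le.2 ⟨by linarith [hp.2.2.1], hp.2.2.2⟩), rfl⟩
  · refine tendsto_atTop_mono (fun N => ?_) hcast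
    rw [eq_surfaceMap_of_mem_axisSegment (N + 10) hp, normSqA_minimalDisk (hpos N)
      (ofReal_mem_paramDomain (hpos N)
        (abs_le.2 ⟨by linarith [hp.2.2.1], by linarith [hp.2.2.2]⟩)), sffNormSq_ofReal]
    have h1 := natCast_le_expMoment_one (N + 10) hp.2.2.2
    have h2 : (1 : ℝ) ≤ (N + 10 : ℕ) := by exact_mod_cast hpos N
    nlinarith
  · have h := isMultivaluedGraph_upper (N := N + 10) (by omega)
    exact ⟨_, _, h, h.halfTurn, disjoint_halves (hpos N), minimalDisk_diff_axisSegment (hpos N)⟩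
  · obtain ⟨C, hC⟩ := exists_sffNormSq_le hδ
    refine ⟨C, fun N => ?_⟩
    rintro _ ⟨⟨z, hz, rfl⟩, h⟩
    exact (normSqA_minimalDisk (hpos N) hz).trans_le (hC _ (hpos N) z hz h)
  · refine tendsto_atTop_mono (fun N => le_sInf_axisDist (hpos N)
      ⟨by linarith [ht.1], by linarith [ht.2]⟩) ?_
    refine Tendsto.atTop_div_const (by norm_num) ?_
    refine tendsto_atTop_mono (fun N => ?_)
      (Real.tendsto_sqrt_atTop.comp (Real.tendsto_sqrt_atTop.comp hcast))
    exact Real.sqrt_le_sqrt (Real.sqrt_le_sqrt (natCast_le_expMoment_one _ ht.2))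

end
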